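/- Let $\Bbbk$ be a commutative ring, let $\Sigma = D^2\setminus\{p_1,\dots,p_n\}$ be a disk with $n\ge 0$ punctures, let $L\subset \Sigma\times[0,1]$ be an oriented link, and let $D\subset\Sigma$ be a diagram of $L$, with ordered crossings. Let $\mathrm{CKh}(D)$ be the Khovanov complex of $D$ over $\Bbbk$, with homological grading $i$ and quantum grading $j$; it is free on the enhanced states $x=\{(C_a,s_a)\}_a$, i.e. complete resolutions of $D$ with a sign $s_a=\pm1$ on each circle $C_a$. Grade the enhanced states by $g^\Sigma(x)=\sum_a s_a[C_a]\in H_1(\Sigma;\mathbb Z)=\mathbb Z^n$, where each $C_a$ is oriented counterclockwise and $H_1(\Sigma;\mathbb Z)$ has the basis of positively oriented loops around the punctures. For $v\in\mathbb Z^n$ let $\mathcal F_v\subseteq \mathrm{CKh}(D)$ be spanned by the enhanced states $x$ with $g^\Sigma(x)\le v$ in the product order. Then the Khovanov differential $d$ satisfies $d^2=0$ and $d(\mathcal F_v)\subseteq\mathcal F_v$ for all $v$. Let $\mathrm{Kh}^{i,j}(L)$ denote the homology of $\mathrm{CKh}(D)$, let $\mathrm{MKh}^{i,j,v}(L\subset\Sigma\times[0,1])$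 denote the homology of the associated graded complex with pieces $\mathcal F_v/\sum_{u<v}\mathcal F_u$, and let $F_p\mathrm{Kh}^{i,j}(L)$ be the set of classes represented by cycles in the span of the enhanced states $x$ for which the sum of the coordinates of $g^\Sigma(x)$ is at most $p$. For every quantum degree $j$ there is a spectral sequence of $\Bbbk$-modules $(E_r^{p,i},d_r)_{r\ge1}$, with $d_r\colon E_r^{p,i}\to E_r^{p-r,\,i+1}$, whose first page is multipunctured Khovanov homology with flattened grading, $$E_1^{p,i}\;\cong\bigoplus_{v\in\mathbb Z^n,\ v_1+\dots+v_n=p}\mathrm{MKh}^{i,j,v}(L\subset\Sigma\times[0,1]),$$ and which converges to the ordinary Khovanov homology $\mathrm{Kh}^{i,j}(L)$: the filtration $F_p\mathrm{Kh}^{i,j}(L)$ is ascending and, for each $i$, is zero for some $p$ and everything for some $p$; and for every $(p,i)$ the differentials $d_r$ to and from $E_r^{p,i}$ vanish for all large $r$, with $E_r^{p,i}\cong F_p\mathrm{Kh}^{i,j}(L)/F_{p-1}\mathrm{Kh}^{i,j}(L)$ for all such $r$. -/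

import Mathlib

open CategoryTheory Filter Topology
open scoped ContDiff DirectSum

noncomputable section

/-! ### Links in a thickened punctured disk -/

/-- A closed unit disk with `n` (distinct, interior) punctures. -/
structure PuncturedDisk (n : ℕ) where
  point : Fin n → ℂ
  injective : Function.Injective point
  norm_lt_one : ∀ k, ‖point k‖ < 1

/-- The thickened punctured disk `Σ × [0, 1]`, as a subset of `ℂ × ℝ`. -/
def PuncturedDisk.thickened {n : ℕ} (P : PuncturedDisk n) : Set (ℂ × ℝ) :=
  {x | ‖x.1‖ ≤ 1 ∧ x.1 ∉ Set.range P.point ∧ x.2 ∈ Set.Icc (0 : ℝ) 1}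

/-- An oriented link in `Σ × [0, 1]`: a smooth embedding of a finite disjoint union of circles
`ℝ / ℤ`, each component being given by a `1`-periodic function on `ℝ`. -/
structure Link {n : ℕ} (P : PuncturedDisk n) where
  components : ℕ
  curve : Fin components → ℝ → ℂ × ℝ
  smooth : ∀ j, ContDiff ℝ ∞ (curve j)
  periodic : ∀ j t, curve j (t + 1) = curve j t
  immersion : ∀ j t, deriv (curve j) t ≠ 0
  injective : ∀ j j' t t', curve j t = curve j' t' → j = j' ∧ ∃ m : ℤ, t' = t + m
  mem : ∀ j t, curve j t ∈ P.thickened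

namespace Link

variable {n : ℕ} {P : PuncturedDisk n}

/-- Ambient isotopy of oriented links in `Σ × [0, 1]`. -/
def AmbientIsotopic (L L' : Link P) : Prop :=
  ∃ H : unitInterval → (P.thickened ≃ₜ P.thickened),
    Continuous (fun p : unitInterval × P.thickened => H p.1 p.2) ∧
    H 0 = Homeomorph.refl _ ∧
    ∃ e : Fin L.components ≃ Fin L'.components, ∀ j, ∃ φ : ℝ → ℝ,
      Continuous φ ∧ StrictMono φ ∧ (∀ t, φ (t + 1) = φ t + 1) ∧
      ∀ t, (H 1 ⟨L.curve j t, L.mem j t⟩ : ℂ × ℝ) = L'.curve (e j) (φ t)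

/-- The projection of a component to the plane. -/
def shadow (L : Link P) (j : Fin L.components) (t : ℝ) : ℂ := (L.curve j t).1

/-- The height of a point of the link. -/
def height (L : Link P) (j : Fin L.components) (t : ℝ) : ℝ := (L.curve j t).2

/-- The image of the link in the plane. -/
def trace (L : Link P) : Set ℂ := ⋃ j, Set.range (L.shadow j)

end Link

/-! ### Link diagrams -/

/-- The underlying `4`-valent oriented graph of a link diagram with crossing data.

At a crossing `c` two strands cross, `(c, false)` and `(c, true)`; they are named so that the
direction of `(c, true)` is obtained from that of `(c, false)` by turning counterclockwise through
an angle less than `π`.  The crossing is positive iff the strand `(c, false)` is the upper one.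
`next` sends a passage through a crossing to the following one along the oriented link.
`loops` counts the components without crossings.  The crossings are numbered, hence ordered. -/
structure CrossingGraph where
  crossings : ℕ
  loops : ℕ
  next : Equiv.Perm (Fin crossings × Bool)
  positive : Fin crossings → Bool

namespace CrossingGraph

variable (G : CrossingGraph)

/-- The edges of the diagram: one leaving each crossing along each of the two strands, and
one for each component without crossings. -/
abbrev Arc : Type := (Fin G.crossings × Bool) ⊕ Fin G.loops

/-- The edge leaving the crossing `c` along the strand `(c, s)`. -/
def outArc (c : Fin G.crossings) (s : Bool) : G.Arc := Sum.inl (c, s)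

/-- The edge arriving at the crossing `c` along the strand `(c, s)`. -/
def inArc (c : Fin G.crossings) (s : Bool) : G.Arc := Sum.inl (G.next.symm (c, s))

/-- Two edges which meet at a crossing. -/
def Meet (e e' : G.Arc) : Prop := ∃ c s s', e = G.inArc c s ∧ e' = G.outArc c s'

/-- The number of connected components of the diagram, as a subset of the plane. -/
def pieces : ℕ := Nat.card (Quot G.Meet)

/-- Two edges which are joined at a crossing in the resolution `S` (`true` stands for the
`1`-resolution).  The `0`-resolution of a positive crossing and the `1`-resolution of a negative
crossing are compatible with the orientation; the other two join the two incoming edges, and the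
two outgoing edges. -/
def Joined (S : Fin G.crossings → Bool) (e e' : G.Arc) : Prop :=
  ∃ c, (S c ≠ G.positive c ∧ ∃ s, e = G.inArc c s ∧ e' = G.outArc c (!s)) ∨
    (S c = G.positive c ∧ ((e = G.inArc c false ∧ e' = G.inArc c true) ∨
      (e = G.outArc c false ∧ e' = G.outArc c true)))

/-- The circles of the resolved diagram `D(S)`. -/
abbrev Circle (S : Fin G.crossings → Bool) : Type := Quot (G.Joined S)

/-- The circle of `D(S)` which runs along a given edge. -/
def circle (S : Fin G.crossings → Bool) (e : G.Arc) : G.Circle S := Quot.mk _ e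

instance (S : Fin G.crossings → Bool) : Fintype (G.Circle S) := Fintype.ofFinite _

/-- Enhanced states: a resolution together with a sign (`true` is `+`) on each circle. -/
abbrev EnhancedState : Type := Σ S : Fin G.crossings → Bool, (G.Circle S → Bool)

instance : Fintype G.EnhancedState := Fintype.ofFinite _

/-! ### The Khovanov complex -/

/-- The multiplication `V ⊗ V → V`: does `v_a ⊗ v_b` map to `v_c`
(all matrix coefficients are `0` or `1`)? -/
def MergeRule : Bool → Bool → Bool → Prop
  | true, true, c => c = true
  | true, false, c => c = false
  | false, true, c => c = false
  | false, false, _ => False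

/-- The comultiplication `V → V ⊗ V`: does `v_b ⊗ v_c` occur in the image of `v_a`? -/
def SplitRule : Bool → Bool → Bool → Prop
  | true, b, c => b ≠ c
  | false, b, c => b = false ∧ c = false

/-- The enhanced state `y` occurs in the image of `x` under the edge map of the cube of resolutions
which changes the crossing `c` from its `0`- to its `1`-resolution.  In every resolution, one of the
two local strands at `c` contains the end of `inArc c false` and the other one contains the
beginning of `outArc c false`. -/
def Occurs (c : Fin G.crossings) (x y : G.EnhancedState) : Prop :=
  let p := G.circle x.1 (G.inArc c false)
  let q := G.circle x.1 (G.outArc c false)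
  let p' := G.circle y.1 (G.inArc c false)
  let q' := G.circle y.1 (G.outArc c false)
  x.1 c = false ∧ y.1 = Function.update x.1 c true ∧
  (∀ e, G.circle x.1 e ≠ p → G.circle x.1 e ≠ q →
    y.2 (G.circle y.1 e) = x.2 (G.circle x.1 e)) ∧
  ((p ≠ q ∧ p' = q' ∧ MergeRule (x.2 p) (x.2 q) (y.2 p')) ∨
    (p = q ∧ p' ≠ q' ∧ SplitRule (x.2 p) (y.2 p') (y.2 q')))

open Classical in
/-- The matrix coefficient of the Khovanov differential from `x` to `y`. -/
def coeff (x y : G.EnhancedState) : ℤ :=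
  ∑ c, if G.Occurs c x y then
    (-1) ^ (Finset.univ.filter fun i => i < c ∧ x.1 i = true).card else 0

/-- The number of positive crossings. -/
def nPos : ℕ := (Finset.univ.filter fun c => G.positive c = true).card

/-- The number of negative crossings. -/
def nNeg : ℕ := (Finset.univ.filter fun c => G.positive c = false).card

/-- The writhe. -/
def writhe : ℤ := (G.nPos : ℤ) - G.nNeg

/-- The number `|S|` of `1`-resolutions. -/
def weight (S : Fin G.crossings → Bool) : ℕ := (Finset.univ.filter fun c => S c = true).card

/-- The sign of a label. -/
def sign (b : Bool) : ℤ := if b = true then 1 else -1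

/-- The homological degree of an enhanced state. -/
def hdeg (x : G.EnhancedState) : ℤ := (G.weight x.1 : ℤ) - G.nNeg

/-- The quantum degree of an enhanced state. -/
def qdeg (x : G.EnhancedState) : ℤ :=
  ∑ C, sign (x.2 C) + ((G.weight x.1 : ℤ) - G.nNeg + G.writhe)

/-- The enhanced states of homological degree `i` and quantum degree `j`. -/
abbrev States (i j : ℤ) : Type := {x : G.EnhancedState // G.hdeg x = i ∧ G.qdeg x = j}

instance (i j : ℤ) : Fintype (G.States i j) := Fintype.ofFinite _

variable (𝕜 : Type*) [CommRing 𝕜]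

/-- The bigraded piece `CKh^{i,j}`, free on the enhanced states of bidegree `(i, j)`. -/
abbrev CKh (i j : ℤ) : Type _ := G.States i j →₀ 𝕜

/-- The Khovanov differential from `CKh^{i,j}` to `CKh^{i',j}`
(it can be nonzero only for `i' = i + 1`). -/
def d (i i' j : ℤ) : G.CKh 𝕜 i j →ₗ[𝕜] G.CKh 𝕜 i' j :=
  Finsupp.linearCombination 𝕜 fun x => ∑ y : G.States i' j, Finsupp.single y (G.coeff x y : 𝕜)

/-- The Khovanov differential squares to zero. -/
def IsComplex : Prop :=
  ∀ i i' i'' j, G.d 𝕜 i' i'' j ∘ₗ G.d 𝕜 i i' j = 0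

end CrossingGraph

/-- The homology `ker g / im f` of `A → B → C` at `B`. -/
abbrev HomologyAt {R A B C : Type*} [CommRing R] [AddCommGroup A] [Module R A]
    [AddCommGroup B] [Module R B] [AddCommGroup C] [Module R C]
    (f : A →ₗ[R] B) (g : B →ₗ[R] C) : Type _ :=
  LinearMap.ker g ⧸ (LinearMap.range f).submoduleOf (LinearMap.ker g)

/-- The quotient `A / (A ∩ B)` of submodules `A`, `B` of a module; it is `A / B` if `B ≤ A`. -/
abbrev SubQuotient {R M : Type*} [CommRing R] [AddCommGroup M] [Module R M]
    (A B : Submodule R M) : Type _ :=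
  A ⧸ B.submoduleOf A

/-- Khovanov homology `Kh^{i,j}`. -/
abbrev CrossingGraph.Kh (G : CrossingGraph) (𝕜 : Type*) [CommRing 𝕜] (i j : ℤ) : Type _ :=
  HomologyAt (G.d 𝕜 (i - 1) i j) (G.d 𝕜 i (i + 1) j)

/-- A link diagram in the plane, drawn in the complement of `n` punctures.  To the graph are
added the regions (the connected components of the complement of the diagram in the plane), the
regions on the left and on the right of each oriented edge, the unbounded region, and the region
containing each puncture.

`corner_*` says which sides of edges share one of the four corners of a crossing; `connected` that
any two regions can be joined by crossing edges; and `euler` is Euler's formula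
`V - E + F = 1 + (number of connected components)` for plane graphs, where `V = crossings`,
`E = 2 * crossings` and `F = regions` (a loop without crossings adds as many vertices as edges).
Together they say that the surface assembled from the regions along the edges is the sphere. -/
structure LinkDiagram (n : ℕ) extends CrossingGraph where
  regions : ℕ
  left : toCrossingGraph.Arc → Fin regions
  right : toCrossingGraph.Arc → Fin regions
  outer : Fin regions
  puncture : Fin n → Fin regions
  corner_front : ∀ c, left (toCrossingGraph.outArc c false) = right (toCrossingGraph.outArc c true)
  corner_left : ∀ c, left (toCrossingGraph.outArc c true) = left (toCrossingGraph.inArc c false)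
  corner_back : ∀ c, right (toCrossingGraph.inArc c false) = left (toCrossingGraph.inArc c true)
  corner_right : ∀ c, right (toCrossingGraph.inArc c true) = right (toCrossingGraph.outArc c false)
  connected : ∀ ρ ρ', Relation.EqvGen (fun a b => ∃ e, left e = a ∧ right e = b) ρ ρ'
  euler : regions = crossings + 1 + toCrossingGraph.pieces

/-- The data which identify `D` as the diagram obtained from `L` by a regular projection. -/
structure Link.Projection {n : ℕ} {P : PuncturedDisk n} (L : Link P) (D : LinkDiagram n) where
  /-- the component, and a parameter, of each passage through a crossing -/
  strand : Fin D.crossings × Bool → Fin L.components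
  time : Fin D.crossings × Bool → ℝ
  /-- a parameter of the following passage -/
  nextTime : Fin D.crossings × Bool → ℝ
  /-- the components without crossings -/
  loop : Fin D.loops → Fin L.components
  /-- the region of a point of the plane off the diagram -/
  region : ℂ → Fin D.regions
  /-- the projection is an immersion, without triple points or tangencies -/
  regular : ∀ j t, deriv (L.shadow j) t ≠ 0
  meet : ∀ c, L.shadow (strand (c, false)) (time (c, false)) =
    L.shadow (strand (c, true)) (time (c, true))
  turn : ∀ c, 0 < ((starRingEnd ℂ) (deriv (L.shadow (strand (c, false))) (time (c, false))) *
    deriv (L.shadow (strand (c, true))) (time (c, true))).im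
  positive_iff : ∀ c, D.positive c = true ↔
    L.height (strand (c, true)) (time (c, true)) < L.height (strand (c, false)) (time (c, false))
  distinct : ∀ x y, strand x = strand y → (∃ m : ℤ, time x = time y + m) → x = y
  complete : ∀ j j' t t', L.shadow j t = L.shadow j' t' → ¬(j = j' ∧ ∃ m : ℤ, t' = t + m) →
    ∃ c s, (strand (c, s) = j ∧ ∃ m : ℤ, t = time (c, s) + m) ∧
      (strand (c, !s) = j' ∧ ∃ m : ℤ, t' = time (c, !s) + m)
  /-- edges run from one passage to the next one -/
  lt_nextTime : ∀ x, time x < nextTime x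
  next_eq : ∀ x, strand (D.next x) = strand x ∧ ∃ m : ℤ, nextTime x = time (D.next x) + m
  no_passage : ∀ x y, strand y = strand x →
    ∀ m : ℤ, time y + m ∉ Set.Ioo (time x) (nextTime x)
  loop_injective : Function.Injective loop
  loop_iff : ∀ j, (∃ l, loop l = j) ↔ ∀ x, strand x ≠ j
  /-- the regions are the connected components of the complement -/
  region_eq_iff : ∀ u v, u ∉ L.trace → v ∉ L.trace →
    (region u = region v ↔ v ∈ connectedComponentIn L.traceᶜ u)
  region_surjective : ∀ ρ, ∃ u, u ∉ L.trace ∧ region u = ρ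
  region_outer : ∀ u : ℂ, 1 < ‖u‖ → region u = D.outer
  region_puncture : ∀ k, region (P.point k) = D.puncture k
  /-- the two sides of each edge -/
  arc_sides : ∀ x, ∀ t ∈ Set.Ioo (time x) (nextTime x), ∀ᶠ ε : ℝ in 𝓝[>] 0,
    region (L.shadow (strand x) t + ε * Complex.I * deriv (L.shadow (strand x)) t) =
      D.left (Sum.inl x) ∧
    region (L.shadow (strand x) t - ε * Complex.I * deriv (L.shadow (strand x)) t) =
      D.right (Sum.inl x)
  loop_sides : ∀ l t, ∀ᶠ ε : ℝ in 𝓝[>] 0,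
    region (L.shadow (loop l) t + ε * Complex.I * deriv (L.shadow (loop l)) t) =
      D.left (Sum.inr l) ∧
    region (L.shadow (loop l) t - ε * Complex.I * deriv (L.shadow (loop l)) t) =
      D.right (Sum.inr l)

/-- `D` is a diagram of the link `L` (considered up to ambient isotopy). -/
def Link.HasDiagram {n : ℕ} {P : PuncturedDisk n} (L : Link P) (D : LinkDiagram n) : Prop :=
  ∃ L' : Link P, L.AmbientIsotopic L' ∧ Nonempty (L'.Projection D)

/-! ### Multipunctured Khovanov homology -/

namespace LinkDiagram

variable {n : ℕ} (D : LinkDiagram n)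

/-- The circle `C` of `D(S)` encloses the region `ρ`.  Here `f` is the indicator function, on the
regions of the diagram, of the inside of `C`: it vanishes on the unbounded region, and
changes exactly across the edges along which `C` runs. -/
def Encloses {S : Fin D.crossings → Bool} (C : D.Circle S) (ρ : Fin D.regions) : Prop :=
  ∃ f : Fin D.regions → Bool, f D.outer = false ∧
    (∀ e, f (D.left e) ≠ f (D.right e) ↔ D.circle S e = C) ∧ f ρ = true

open Classical in
/-- The homology class in `H₁(Σ; ℤ) = ℤⁿ` of the circle `C`, oriented counterclockwise, in the
basis of positively oriented loops around the punctures. -/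
def homologyClass {S : Fin D.crossings → Bool} (C : D.Circle S) : Fin n → ℤ :=
  fun k => if D.Encloses C (D.puncture k) then 1 else 0

/-- The `H₁(Σ; ℤ)`-grading of an enhanced state, the signed sum of the classes of its circles. -/
def mdeg (x : D.EnhancedState) : Fin n → ℤ :=
  ∑ C, CrossingGraph.sign (x.2 C) • D.homologyClass C

variable (𝕜 : Type*) [CommRing 𝕜]

/-- The filtration of `CKh^{i,j}` by `ℤⁿ` with its product order. -/
def filt (i j : ℤ) (v : Fin n → ℤ) : Submodule 𝕜 (D.CKh 𝕜 i j) :=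
  Finsupp.supported 𝕜 𝕜 {x | D.mdeg x ≤ v}

/-- The sum of the earlier steps of the filtration. -/
def filtLT (i j : ℤ) (v : Fin n → ℤ) : Submodule 𝕜 (D.CKh 𝕜 i j) :=
  ⨆ u, ⨆ _ : u < v, D.filt 𝕜 i j u

/-- The Khovanov differential respects the filtration. -/
def IsFiltered : Prop :=
  ∀ i i' j v, D.filt 𝕜 i j v ≤ (D.filt 𝕜 i' j v).comap (D.d 𝕜 i i' j)

/-- The associated graded module in degree `v`. -/
abbrev Gr (i j : ℤ) (v : Fin n → ℤ) : Type _ :=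
  SubQuotient (D.filt 𝕜 i j v) (D.filtLT 𝕜 i j v)

variable {D 𝕜}

theorem IsFiltered.filtLT_le (hF : D.IsFiltered 𝕜) (i i' j : ℤ) (v : Fin n → ℤ) :
    D.filtLT 𝕜 i j v ≤ (D.filtLT 𝕜 i' j v).comap (D.d 𝕜 i i' j) := by
  refine iSup₂_le fun u hu => (hF i i' j u).trans (Submodule.comap_mono ?_)
  exact le_iSup₂_of_le u hu le_rfl

/-- The differential which the Khovanov differential induces on the associated graded module. -/
def IsFiltered.grD (hF : D.IsFiltered 𝕜) (i i' j : ℤ) (v : Fin n → ℤ) :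
    D.Gr 𝕜 i j v →ₗ[𝕜] D.Gr 𝕜 i' j v :=
  Submodule.mapQ _ _ ((D.d 𝕜 i i' j).restrict fun _ hx => hF i i' j v hx)
    fun _ hx => hF.filtLT_le i i' j v hx

/-- Multipunctured Khovanov homology `MKh^{i,j,v}`, the homology of the associated graded complex. -/
abbrev IsFiltered.MKh (hF : D.IsFiltered 𝕜) (i j : ℤ) (v : Fin n → ℤ) : Type _ :=
  HomologyAt (hF.grD (i - 1) i j v) (hF.grD i (i + 1) j v)

/-- `MKh` with flattened grading: the sum of all `MKh^{i,j,v}` such that the coordinates of `v`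
add up to `p`. -/
abbrev IsFiltered.flatMKh (hF : D.IsFiltered 𝕜) (i j p : ℤ) : Type _ :=
  ⨁ v : {v : Fin n → ℤ // ∑ k, v k = p}, hF.MKh i j v.1

variable (D 𝕜)

/-- The flattened `ℤ`-filtration of `CKh^{i,j}`. -/
def flatFilt (i j p : ℤ) : Submodule 𝕜 (D.CKh 𝕜 i j) :=
  Finsupp.supported 𝕜 𝕜 {x | ∑ k, D.mdeg x k ≤ p}

/-- The filtration of Khovanov homology induced by the flattened filtration: the classes which are
represented by cycles of filtration degree at most `p`. -/
def flatFiltKh (i j p : ℤ) : Submodule 𝕜 (D.Kh 𝕜 i j) :=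
  ((D.flatFilt 𝕜 i j p).submoduleOf (LinearMap.ker (D.d 𝕜 i (i + 1) j))).map (Submodule.mkQ _)

end LinkDiagram

/-! ### Spectral sequences of filtered complexes -/

/-- Spectral sequences of `𝕜`-modules which start with the page `E_1`, graded by the pairs
`(p, i)` of a filtration degree `p` and a homological degree `i`, as for ascending filtrations of
complexes with differential of degree `1`: the differential `d_r` goes from `(p, i)` to
`(p - r, i + 1)`. -/
abbrev FiltrationSpectralSequence.{u} (𝕜 : Type u) [CommRing 𝕜] :=
  SpectralSequence (ModuleCat.{u} 𝕜) (fun r : ℤ => ComplexShape.up' ((-r, 1) : ℤ × ℤ)) 1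

/-- `E` converges to the graded module `H` with the ascending filtration `F`: the filtration is
exhaustive, bounded below, and bounded above in each degree, and at each place `(p, i)` the
differentials from and to it eventually vanish, the pages from then on being `F_p H^i / F_{p-1} H^i`. -/
def FiltrationSpectralSequence.ConvergesTo.{u} {𝕜 : Type u} [CommRing 𝕜]
    (E : FiltrationSpectralSequence 𝕜)
    (H : ℤ → Type u) [∀ i, AddCommGroup (H i)] [∀ i, Module 𝕜 (H i)]
    (F : ∀ i, ℤ → Submodule 𝕜 (H i)) : Prop :=
  (∀ i, Monotone (F i) ∧ (∃ p, F i p = ⊥) ∧ ∃ p, F i p = ⊤) ∧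
  ∀ p i : ℤ, ∃ r₁ : ℤ, 1 ≤ r₁ ∧ ∀ (r : ℤ) (hr : 1 ≤ r), r₁ ≤ r →
    (E.page r hr).d (p, i) (p - r, i + 1) = 0 ∧
    (E.page r hr).d (p + r, i - 1) (p, i) = 0 ∧
    Nonempty ((E.page r hr).X (p, i) ≅
      ModuleCat.of 𝕜 (SubQuotient (F i p) (F i (p - 1))))

end

/-! The proof rests on planarity, the Frobenius algebra `ℤ[X]/X²`, and the general theory of
filtered complexes.

Planarity enters through `LinkDiagram.range_coboundary`: connectivity and Euler's formula force
every mod 2 cycle of edges to bound a set of regions. Applied to all edges, this gives a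
checkerboard colouring; applied to a circle of a resolution, it gives the inside of that circle. The
colouring orients the edges so that both resolutions of a crossing join an arriving edge to a
departing one. The circles are then the cycles of a permutation `walk`, and changing one resolution
composes it with a transposition. Hence each edge of the cube either merges two circles or splits
one (`isEdge_circleRel`); a circle is never reconnected to itself.

For `d² = 0`, labels are carried by the edges of the diagram, constant along circles, so that all
vertices of the cube share one ambient module. Merge and split maps commute with multiplication by
`X` at any edge, so a composite is determined by its value on the unit. Comparing these values shows
that the unsigned squares commute (`edge_comm`), and the signs of the cube make them anticommute.

For the filtration, insides add modulo 2 when circles merge. At each puncture only four patterns of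
winding numbers remain, and a finite check against the sign rules shows that no coordinate of the
degree increases (`mdeg_le_of_coeff_ne_zero`).

The spectral sequence is built from approximate cycles `Z` and boundaries `B` of the flattened
filtration. It converges because there are finitely many enhanced states, so the filtration is
bounded. On the first page, a strict drop in the product order strictly lowers the coordinate sum.
The differential preserving this sum therefore preserves each multidegree, and the page splits as
the direct sum of the groups `MKh` (`firstPageEquiv`). -/

/-! ### Cycles of a permutation composed with a transposition -/

namespace Equiv.Perm

variable {α : Type*} [DecidableEq α]

/-- From `a` the new permutation jumps to `σ b` and then follows the `σ`-cycle of `b`, which avoids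
`a`, until it reaches `b`. -/
theorem sameCycle_mul_swap_of_not [Finite α] {σ : Perm α} {a b : α} (h : ¬ σ.SameCycle a b) :
    (σ * swap a b).SameCycle a b := by
  by_contra hn
  have key : ∀ k : ℕ, (σ * swap a b).SameCycle a ((σ ^ (k + 1)) b) := by
    intro k
    induction k with
    | zero =>
      have : (σ * swap a b) a = (σ ^ (0 + 1)) b := by simp
      rw [← this]
      exact (sameCycle_apply_right).2 (SameCycle.refl _ _)
    | succ k ih =>
      have hb : (σ ^ (k + 1)) b ≠ b := fun e => hn (by rw [e] at ih; exact ih)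
      have ha : (σ ^ (k + 1)) b ≠ a := fun e =>
        h (SameCycle.symm ⟨(k + 1 : ℕ), by rw [zpow_natCast]; exact e⟩)
      have : (σ * swap a b) ((σ ^ (k + 1)) b) = (σ ^ (k + 1 + 1)) b := by
        rw [Perm.mul_apply, swap_apply_of_ne_of_ne ha hb, pow_succ' σ (k + 1), Perm.mul_apply]
      rw [← this]
      exact (sameCycle_apply_right).2 ih
  -- With this exponent the orbit has come back to `b` itself.
  have h1 := key (orderOf σ - 1)
  rw [Nat.sub_add_cancel (orderOf_pos σ), pow_orderOf_eq_one] at h1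
  exact hn h1

/-- The `σ`-path from `a` to its first visit of `b` closes up under the new permutation, and `a` is
cut off from it. -/
theorem not_sameCycle_mul_swap [Finite α] {σ : Perm α} {a b : α} (hab : a ≠ b)
    (h : σ.SameCycle a b) : ¬ (σ * swap a b).SameCycle a b := by
  classical
  have hex : ∃ k : ℕ, 0 < k ∧ (σ ^ k) a = b := by
    obtain ⟨k, hk0, -, hk⟩ := h.exists_pow_eq''
    exact ⟨k, hk0, hk⟩
  obtain ⟨hk0, hkb⟩ := Nat.find_spec hex
  have hmin := fun m => Nat.find_min (m := m) hex
  generalize Nat.find hex = k at hk0 hkb hmin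
  have hna : ∀ m, 0 < m → m ≤ k → (σ ^ m) a ≠ a := by
    intro m hm hmk e
    rcases hmk.eq_or_lt with rfl | hlt
    · exact hab (e.symm.trans hkb)
    · refine hmin (k - m) (by omega) ⟨by omega, ?_⟩
      rw [← hkb]
      conv_rhs => rw [← Nat.sub_add_cancel hlt.le, pow_add, Perm.mul_apply, e]
  -- The path `σ a, …, σ ^ k a = b` omits `a` and is stable: from `b` the new permutation returns to
  -- `σ a`.
  let s : Set α := {x | ∃ m, 0 < m ∧ m ≤ k ∧ (σ ^ m) a = x}
  have hs : ∀ x ∈ s, (σ * swap a b) x ∈ s := by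
    rintro x ⟨m, hm, hmk, rfl⟩
    rcases hmk.eq_or_lt with rfl | hlt
    · rw [hkb, Perm.mul_apply, swap_apply_right]
      exact ⟨1, one_pos, hk0, by simp⟩
    · rw [Perm.mul_apply, swap_apply_of_ne_of_ne (hna m hm hmk)
        (fun e => hmin m hlt ⟨hm, e⟩)]
      exact ⟨m + 1, by omega, hlt, by rw [pow_succ', Perm.mul_apply]⟩
  have hs' : ∀ j : ℕ, ((σ * swap a b) ^ j) b ∈ s := by
    intro j
    induction j with
    | zero => exact ⟨k, hk0, le_rfl, by simpa using hkb⟩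
    | succ j ih => rw [pow_succ', Perm.mul_apply]; exact hs _ ih
  intro hc
  obtain ⟨j, -, hj⟩ := hc.symm.exists_pow_eq'
  obtain ⟨m, hm, hmk, e⟩ := hs' j
  exact hna m hm hmk (e.trans hj)

theorem sameCycle_mul_swap_iff [Finite α] {σ : Perm α} {a b : α} (hab : a ≠ b) :
    (σ * swap a b).SameCycle a b ↔ ¬ σ.SameCycle a b :=
  ⟨fun h h' => not_sameCycle_mul_swap hab h' h, sameCycle_mul_swap_of_not⟩

end Equiv.Perm

/-! ### Merging two classes of an equivalence relation -/

/-- The equivalence relation `r'` arises from `r` by merging the distinct classes of `u`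
and `v`. -/
structure Setoid.IsMerge {α : Type*} (r r' : Setoid α) (u v : α) : Prop where
  not_rel : ¬ r u v
  rel_iff : ∀ a b, r' a b ↔ r a b ∨ (r a u ∧ r v b) ∨ (r a v ∧ r u b)

namespace Setoid.IsMerge

variable {α : Type*} {r r' : Setoid α} {u v : α}

theorem rel (h : r.IsMerge r' u v) : r' u v :=
  (h.rel_iff u v).2 (Or.inr (Or.inl ⟨r.refl u, r.refl v⟩))

theorem le (h : r.IsMerge r' u v) : r ≤ r' := fun a b hab => (h.rel_iff a b).2 (Or.inl hab)

theorem rel_left_iff (h : r.IsMerge r' u v) (a : α) : r' u a ↔ r u a ∨ r v a := by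
  rw [h.rel_iff]
  constructor
  · rintro (h1 | ⟨-, h1⟩ | ⟨-, h1⟩) <;> tauto
  · rintro (h1 | h1)
    · exact Or.inl h1
    · exact Or.inr (Or.inl ⟨r.refl _, h1⟩)

/-- A class other than those of `u` and `v` does not change. -/
theorem rel_iff_of_not (h : r.IsMerge r' u v) {e : α} (h1 : ¬ r u e) (h2 : ¬ r v e) (a : α) :
    r' e a ↔ r e a := by
  rw [h.rel_iff]
  constructor
  · rintro (h3 | ⟨h3, -⟩ | ⟨h3, -⟩)
    · exact h3
    · exact absurd (r.symm h3) h1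
    · exact absurd (r.symm h3) h2
  · exact Or.inl

/-- Two elements which are identified by merging `u` and `v` represent the same two classes. -/
theorem rel_or_rel (h : r.IsMerge r' u v) {a b : α} (hab : ¬ r a b) (hab' : r' a b) :
    (r a u ∧ r b v) ∨ (r a v ∧ r b u) := by
  rcases (h.rel_iff a b).1 hab' with h1 | ⟨h1, h2⟩ | ⟨h1, h2⟩
  · exact absurd h1 hab
  · exact Or.inl ⟨h1, r.symm h2⟩
  · exact Or.inr ⟨h1, r.symm h2⟩

end Setoid.IsMerge

/-- Summing over the classes before and after a merge. -/
theorem Setoid.IsMerge.sum_add {α Q Q' : Type*} [Fintype Q] [Fintype Q'] {π : α → Q}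
    {π' : α → Q'} (hπ : Function.Surjective π) (hπ' : Function.Surjective π') {u v : α}
    (h : (Setoid.ker π).IsMerge (Setoid.ker π') u v) (F : Q → ℤ) (G : Q' → ℤ)
    (hFG : ∀ e, π e ≠ π u → π e ≠ π v → F (π e) = G (π' e)) :
    ∑ C, F C + G (π' u) = ∑ C, G C + (F (π u) + F (π v)) := by
  classical
  have huv : π u ≠ π v := h.not_rel
  have hL : ∀ e, π' u = π' e ↔ π u = π e ∨ π v = π e := h.rel_left_iff
  -- The classes other than those of `u` and `v` correspond bijectively, by passing through
  -- representatives.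
  have key : ∑ C ∈ Finset.univ \ {π u, π v}, F C = ∑ C ∈ Finset.univ \ {π' u}, G C := by
    refine Finset.sum_bij (fun C _ => π' (Function.surjInv hπ C)) ?_ ?_ ?_ ?_
    · intro C hC
      obtain ⟨e, he⟩ : ∃ e, Function.surjInv hπ C = e := ⟨_, rfl⟩
      have hCe : π e = C := he ▸ Function.surjInv_eq hπ C
      simp only [Finset.mem_sdiff, Finset.mem_univ, true_and, Finset.mem_insert,
        Finset.mem_singleton, not_or, he] at hC ⊢
      intro h1
      rcases (hL e).1 h1.symm with h2 | h2
      · exact hC.1 (hCe.symm.trans h2.symm)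
      · exact hC.2 (hCe.symm.trans h2.symm)
    · intro C hC C' hC' hCC
      simp only [Finset.mem_sdiff, Finset.mem_univ, true_and, Finset.mem_insert,
        Finset.mem_singleton, not_or] at hC
      have h1 := Function.surjInv_eq hπ C
      have h2 := Function.surjInv_eq hπ C'
      have h3 := (h.rel_iff_of_not (e := Function.surjInv hπ C) (fun h => hC.1 (h1 ▸ Eq.symm h))
        (fun h => hC.2 (h1 ▸ Eq.symm h)) (Function.surjInv hπ C')).1 hCC
      exact (h1.symm.trans h3).trans h2
    · intro C' hC'
      obtain ⟨e, rfl⟩ := hπ' C'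
      have he : ¬ (π u = π e ∨ π v = π e) := by
        rw [← hL]
        simpa [eq_comm] using hC'
      rw [not_or] at he
      refine ⟨π e, by simpa [eq_comm] using he, ?_⟩
      exact ((h.rel_iff_of_not he.1 he.2 _).2 (Function.surjInv_eq hπ (π e)).symm).symm
    · intro C hC
      simp only [Finset.mem_sdiff, Finset.mem_univ, true_and, Finset.mem_insert,
        Finset.mem_singleton, not_or] at hC
      have h1 := Function.surjInv_eq hπ C
      conv_lhs => rw [← h1]
      exact hFG _ (by rw [h1]; exact hC.1) (by rw [h1]; exact hC.2)
  have e1 := Finset.sum_sdiff (f := F) (Finset.subset_univ {π u, π v})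
  have e2 := Finset.sum_sdiff (f := G) (Finset.subset_univ {π' u})
  rw [Finset.sum_pair huv] at e1
  rw [Finset.sum_singleton] at e2
  linarith

/-- This count excludes the impossible merge/split patterns in `Labelling.edge_comm`. -/
theorem Setoid.IsMerge.card_eq {α : Type*} [Finite α] {r r' : Setoid α} {u v : α}
    (h : r.IsMerge r' u v) : Nat.card (Quotient r) = Nat.card (Quotient r') + 1 := by
  classical
  have := Fintype.ofFinite (Quotient r)
  have := Fintype.ofFinite (Quotient r')
  have h1 := Setoid.IsMerge.sum_add (π := Quotient.mk r) (π' := Quotient.mk r')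
    Quotient.mk_surjective Quotient.mk_surjective (u := u) (v := v)
    (by rw [Setoid.ker_mk_eq, Setoid.ker_mk_eq]; exact h) (fun _ => 1) (fun _ => 1)
    (fun _ _ _ => rfl)
  simp only [Finset.sum_const, Finset.card_univ, mul_one, nsmul_eq_mul] at h1
  rw [Nat.card_eq_fintype_card, Nat.card_eq_fintype_card]
  omega

/-! ### The Frobenius algebra of labelled circles -/

namespace Labelling

open CrossingGraph Classical

variable {A : Type*}

/-- The labelling `x` of the points is constant on the classes of `r`. -/
def IsConst (r : Setoid A) (x : A → Bool) : Prop := ∀ a b, r a b → x a = x b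

/-- Change the label of the class of `e` to `-`. -/
noncomputable def lower (r : Setoid A) (e : A) (x : A → Bool) : A → Bool :=
  fun a => if r e a then false else x a

/-- `y` occurs in the image of `x` under the merge or split map at the points `u` and `v`. -/
def Rule (r r' : Setoid A) (u v : A) (x y : A → Bool) : Prop :=
  IsConst r' y ∧ (∀ e, ¬ r e u → ¬ r e v → y e = x e) ∧
    ((¬ r u v ∧ r' u v ∧ MergeRule (x u) (x v) (y u)) ∨
      (r u v ∧ ¬ r' u v ∧ SplitRule (x u) (y u) (y v)))

theorem IsConst.lower {r : Setoid A} {x : A → Bool} (hx : IsConst r x) (e : A) :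
    IsConst r (lower r e x) := by
  intro a b hab
  have : r e a ↔ r e b := ⟨fun h => r.trans h hab, fun h => r.trans h (r.symm hab)⟩
  simp only [Labelling.lower, this, hx a b hab]

/-- The label obtained by merging the classes of `u` and `v`. -/
noncomputable def merged (r' : Setoid A) (u v : A) (x : A → Bool) : A → Bool :=
  fun a => if r' u a then x u && x v else x a

/-- With `true` as `1` and `false` as `X`, the product of labels is `&&`, except that `X * X` is
zero. The other labels are fixed by the rule, so at most one `y` occurs. -/
theorem rule_merge_iff {r r' : Setoid A} {u v : A} (h : r.IsMerge r' u v) {x : A → Bool}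
    (hx : IsConst r x) (y : A → Bool) :
    Rule r r' u v x y ↔ (x u || x v) = true ∧ y = merged r' u v x := by
  have hn := h.not_rel
  have hr := h.rel
  constructor
  · rintro ⟨hy, hxy, ⟨-, -, hm⟩ | ⟨h1, -⟩⟩
    · have hyu : (x u || x v) = true ∧ y u = (x u && x v) := by
        revert hm
        cases x u <;> cases x v <;> simp [MergeRule]
      refine ⟨hyu.1, funext fun a => ?_⟩
      unfold merged
      split_ifs with ha
      · rw [← hy u a ha, hyu.2]
      · rw [h.rel_left_iff, not_or] at ha
        exact hxy a (fun h => ha.1 (r.symm h)) (fun h => ha.2 (r.symm h))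
    · exact absurd h1 hn
  · rintro ⟨h1, rfl⟩
    refine ⟨fun a b hab => ?_, fun e he1 he2 => ?_, Or.inl ⟨hn, hr, ?_⟩⟩
    · by_cases ha : r' u a
      · have hb : r' u b := r'.trans ha hab
        simp [merged, ha, hb]
      · have hb : ¬ r' u b := fun h => ha (r'.trans h (r'.symm hab))
        simp only [merged, ha, hb, if_false]
        rw [h.rel_left_iff, not_or] at ha
        exact hx a b ((h.rel_iff_of_not ha.1 ha.2 b).1 hab)
    · have : ¬ r' u e := by
        rw [h.rel_left_iff, not_or]
        exact ⟨fun h => he1 (r.symm h), fun h => he2 (r.symm h)⟩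
      simp [merged, this]
    · have : merged r' u v x u = (x u && x v) := by simp [merged]
      rw [this]
      revert h1
      cases x u <;> cases x v <;> simp [MergeRule]

/-- This is `Δ(1) = X ⊗ 1 + 1 ⊗ X` and `Δ(X) = X ⊗ X`. As functions on points, the first lowers one
of the two halves and the second leaves the labelling unchanged. -/
theorem rule_split_iff {r r' : Setoid A} {u v : A} (h : r'.IsMerge r u v) {x : A → Bool}
    (hx : IsConst r x) (y : A → Bool) :
    Rule r r' u v x y ↔ (x u = true ∧ (y = lower r' u x ∨ y = lower r' v x)) ∨
      (x u = false ∧ y = x) := by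
  have hn := h.not_rel
  have hr := h.rel
  have hxx : x v = x u := hx v u (r.symm hr)
  have hx' : IsConst r' x := fun a b hab => hx a b (h.le hab)
  have hvu : ¬ r' v u := fun h => hn (r'.symm h)
  constructor
  · rintro ⟨hy, hxy, ⟨h1, -⟩ | ⟨-, -, hm⟩⟩
    · exact absurd hr h1
    -- The two values `y u` and `y v` determine `y`.
    · have key : ∀ a, y a = if r' u a then y u else if r' v a then y v else x a := by
        intro a
        split_ifs with h1 h2
        · exact (hy u a h1).symm
        · exact (hy v a h2).symm
        · refine hxy a (fun h3 => ?_) (fun h3 => ?_)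
          · rcases (h.rel_left_iff a).1 (r.symm h3) with h4 | h4 <;> tauto
          · rcases (h.rel_left_iff a).1 (r.trans hr (r.symm h3)) with h4 | h4 <;> tauto
      cases hxu : x u
      · right
        rw [hxu] at hm
        refine ⟨rfl, funext fun a => ?_⟩
        rw [key a, hm.1, hm.2]
        split_ifs with h1 h2
        · rw [← hx' u a h1, hxu]
        · rw [← hx' v a h2, hxx, hxu]
        · rfl
      · left
        refine ⟨rfl, ?_⟩
        rw [hxu] at hm
        have hm' : y u ≠ y v := hm
        cases hyu : y u
        · left
          have hyv : y v = true := by rw [hyu] at hm'; simpa using hm'.symm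
          funext a
          rw [key a, hyu, hyv]
          unfold lower
          split_ifs with h1 h2
          · rfl
          · rw [← hx' v a h2, hxx, hxu]
          · rfl
        · right
          have hyv : y v = false := by rw [hyu] at hm'; simpa using hm'.symm
          funext a
          rw [key a, hyu, hyv]
          unfold lower
          split_ifs with h1 h2 h2
          · exact absurd (r'.trans h1 (r'.symm h2)) hn
          · rw [← hx' u a h1, hxu]
          · rfl
          · rfl
  · have hlow : ∀ w, r u w → ∀ e, ¬ r e u → ¬ r e v → lower r' w x e = x e := by
      intro w hw e he1 he2
      have : ¬ r' w e := fun h3 => he1 (r.symm (r.trans hw (h.le h3)))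
      simp [lower, this]
    rintro (⟨h1, rfl | rfl⟩ | ⟨h1, rfl⟩)
    · refine ⟨hx'.lower u, hlow u (r.refl u), Or.inr ⟨hr, hn, ?_⟩⟩
      simp [lower, h1, hn, hxx, SplitRule]
    · refine ⟨hx'.lower v, hlow v hr, Or.inr ⟨hr, hn, ?_⟩⟩
      simp [lower, h1, hvu, SplitRule]
    · refine ⟨hx', fun _ _ _ => rfl, Or.inr ⟨hr, hn, ?_⟩⟩
      rw [hxx, h1]
      exact ⟨rfl, rfl⟩

/-- Formal integral combinations of labellings. -/
abbrev Vec (A : Type*) := (A → Bool) →₀ ℤ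

/-- Multiplication by the generator of the Frobenius algebra `ℤ[X]/X²` on the class of `e`. -/
noncomputable def mulX (r : Setoid A) (e : A) : Vec A →ₗ[ℤ] Vec A :=
  Finsupp.linearCombination ℤ fun x => if x e then Finsupp.single (lower r e x) 1 else 0

theorem mulX_single (r : Setoid A) (e : A) (x : A → Bool) :
    mulX r e (Finsupp.single x 1) = if x e then Finsupp.single (lower r e x) 1 else 0 := by
  simp [mulX]

/-- Combinations of labellings of the classes of `r`. -/
noncomputable def constVec (r : Setoid A) : Submodule ℤ (Vec A) :=
  Finsupp.supported ℤ ℤ {x | IsConst r x}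

theorem single_mem_constVec {r : Setoid A} {x : A → Bool} (hx : IsConst r x) (c : ℤ) :
    Finsupp.single x c ∈ constVec r := Finsupp.single_mem_supported ℤ c hx

theorem eqOn_constVec {r : Setoid A} {M : Type*} [AddCommGroup M] {f g : Vec A →ₗ[ℤ] M}
    (h : ∀ x, IsConst r x → f (Finsupp.single x 1) = g (Finsupp.single x 1)) :
    ∀ w ∈ constVec r, f w = g w := by
  intro w hw
  rw [constVec, Finsupp.supported_eq_span_single] at hw
  exact LinearMap.eqOn_span (by rintro _ ⟨x, hx, rfl⟩; exact h x hx) hw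

theorem mulX_congr {r : Setoid A} {e f : A} (h : r e f) :
    ∀ w ∈ constVec r, mulX r e w = mulX r f w := by
  refine eqOn_constVec fun x hx => ?_
  have hl : lower r e x = lower r f x := by
    funext a
    have : r e a ↔ r f a := ⟨fun h' => r.trans (r.symm h) h', fun h' => r.trans h h'⟩
    simp only [lower, this]
  rw [mulX_single, mulX_single, hx e f h, hl]

/-- Both orders lower the two classes; if the classes coincide both vanish, as `X² = 0`. -/
theorem mulX_comm (r : Setoid A) (e f : A) (w : Vec A) :
    mulX r e (mulX r f w) = mulX r f (mulX r e w) := by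
  suffices h : mulX r e ∘ₗ mulX r f = mulX r f ∘ₗ mulX r e from LinearMap.congr_fun h w
  refine Finsupp.lhom_ext' fun x => LinearMap.ext_ring ?_
  simp only [LinearMap.comp_apply, Finsupp.lsingle_apply, mulX_single]
  have hl : lower r e (lower r f x) = lower r f (lower r e x) := by
    funext a; simp only [lower]; split_ifs <;> rfl
  have hs : r e f ↔ r f e := ⟨r.symm, r.symm⟩
  by_cases he : x e = true <;> by_cases hf : x f = true <;>
    by_cases hef : r e f <;>
    simp [he, hf, mulX_single, lower, hef, hs.not.1, hs.1, hl]

/-- The unit: all labels are `+`. -/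
noncomputable def unit (A : Type*) : Vec A := Finsupp.single (fun _ => true) 1

theorem unit_mem (r : Setoid A) : unit A ∈ constVec r :=
  single_mem_constVec (fun _ _ _ => rfl) 1

variable [Fintype A]

/-- The merge or split map between labellings of the classes of `r` and `r'`. -/
noncomputable def edge (r r' : Setoid A) (u v : A) : Vec A →ₗ[ℤ] Vec A :=
  Finsupp.linearCombination ℤ fun x =>
    ∑ y, if Rule r r' u v x y then Finsupp.single y 1 else 0

theorem edge_single (r r' : Setoid A) (u v : A) (x : A → Bool) :
    edge r r' u v (Finsupp.single x 1) =
      ∑ y, if Rule r r' u v x y then Finsupp.single y 1 else 0 := by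
  simp [edge]

theorem edge_merge {r r' : Setoid A} {u v : A} (h : r.IsMerge r' u v) {x : A → Bool}
    (hx : IsConst r x) : edge r r' u v (Finsupp.single x 1) =
      if (x u || x v) = true then Finsupp.single (merged r' u v x) 1 else 0 := by
  simp only [edge_single, rule_merge_iff h hx]
  split_ifs with h1
  · simp [h1, -Bool.or_eq_true]
  · simp [h1, -Bool.or_eq_true]

theorem edge_split {r r' : Setoid A} {u v : A} (h : r'.IsMerge r u v) {x : A → Bool}
    (hx : IsConst r x) : edge r r' u v (Finsupp.single x 1) =
      if x u = true then Finsupp.single (lower r' u x) 1 + Finsupp.single (lower r' v x) 1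
      else Finsupp.single x 1 := by
  simp only [edge_single, rule_split_iff h hx]
  split_ifs with h1
  · have hne : lower r' u x ≠ lower r' v x := by
      intro e
      have h2 := congrFun e u
      have hvu : ¬ r' v u := fun h' => h.not_rel (r'.symm h')
      simp [lower, hvu, h1] at h2
    rw [← Finset.sum_filter]
    have : (Finset.univ.filter fun y => (x u = true ∧ (y = lower r' u x ∨ y = lower r' v x)) ∨
        (x u = false ∧ y = x)) = {lower r' u x, lower r' v x} := by
      ext y; simp [h1]
    rw [this, Finset.sum_pair hne]
  · simp [h1]

theorem edge_mem (r r' : Setoid A) (u v : A) (w : Vec A) : edge r r' u v w ∈ constVec r' := by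
  induction w using Finsupp.induction_linear with
  | zero => simp
  | add a b ha hb => rw [map_add]; exact add_mem ha hb
  | single x c =>
    rw [← mul_one c, ← smul_eq_mul, ← Finsupp.smul_single, map_smul, edge_single]
    refine Submodule.smul_mem _ _ (Submodule.sum_mem _ fun y _ => ?_)
    split_ifs with h
    · exact single_mem_constVec h.1 1
    · exact zero_mem _

/-- Multiplying one factor by `X` multiplies the product by `X`. The cases are whether `e` lies on
the circle of `u`, on that of `v`, or on neither. -/
theorem edge_mulX_merge {r r' : Setoid A} {u v : A} (h : r.IsMerge r' u v) (e : A) :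
    ∀ w ∈ constVec r, edge r r' u v (mulX r e w) = mulX r' e (edge r r' u v w) := by
  refine eqOn_constVec (f := edge r r' u v ∘ₗ mulX r e) (g := mulX r' e ∘ₗ edge r r' u v)
    fun x hx => ?_
  have hL := h.rel_left_iff
  rw [LinearMap.comp_apply, LinearMap.comp_apply, edge_merge h hx, mulX_single,
    apply_ite (edge r r' u v), map_zero, edge_merge h (hx.lower e), apply_ite (mulX r' e),
    map_zero, mulX_single]
  have huv := h.not_rel
  by_cases hu : r u e
  · have hxe : x e = x u := (hx u e hu).symm
    have hve : ¬ r e v := fun h' => huv (r.trans hu h')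
    have h1 : merged r' u v x e = (x u && x v) := by simp [merged, hL, hu]
    have h2 : lower r e x u = false := by simp [lower, r.symm hu]
    have h3 : lower r e x v = x v := by simp [lower, hve]
    have h4 : merged r' u v (lower r e x) = lower r' e (merged r' u v x) := by
      funext a
      have : r' e a ↔ r' u a := ⟨r'.trans (h.le hu), r'.trans (r'.symm (h.le hu))⟩
      simp only [merged, h2, h3]
      simp only [lower, merged, this]
      by_cases ha : r' u a
      · simp [ha]
      · have : ¬ r e a := fun h' => ha (h.le (r.trans hu h'))
        simp [ha, this]
    rw [hxe, h1, h2, h3, h4]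
    cases x u <;> cases x v <;> simp
  · by_cases hv : r v e
    · have hxe : x e = x v := (hx v e hv).symm
      have hue : ¬ r e u := fun h' => hu (r.symm h')
      have h1 : merged r' u v x e = (x u && x v) := by simp [merged, hL, hv]
      have h2 : lower r e x u = x u := by simp [lower, hue]
      have h3 : lower r e x v = false := by simp [lower, r.symm hv]
      have hr' : r' u e := (hL e).2 (Or.inr hv)
      have h4 : merged r' u v (lower r e x) = lower r' e (merged r' u v x) := by
        funext a
        have : r' e a ↔ r' u a := ⟨r'.trans hr', r'.trans (r'.symm hr')⟩
        simp only [merged, h2, h3]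
        simp only [lower, merged, this]
        by_cases ha : r' u a
        · simp [ha]
        · have : ¬ r e a := fun h' => ha (r'.trans hr' (h.le h'))
          simp [ha, this]
      rw [hxe, h1, h2, h3, h4]
      cases x u <;> cases x v <;> simp
    · have hue : ¬ r e u := fun h' => hu (r.symm h')
      have hve : ¬ r e v := fun h' => hv (r.symm h')
      have hr' : ¬ r' u e := by rw [hL]; tauto
      have h1 : merged r' u v x e = x e := by simp [merged, hr']
      have h2 : lower r e x u = x u := by simp [lower, hue]
      have h3 : lower r e x v = x v := by simp [lower, hve]
      have h4 : merged r' u v (lower r e x) = lower r' e (merged r' u v x) := by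
        funext a
        simp only [merged, h2, h3]
        simp only [lower, merged, h.rel_iff_of_not hu hv]
        by_cases ha : r e a
        · have : ¬ r' u a := fun h' => hr' (r'.trans h' (r'.symm (h.le ha)))
          simp [ha, this]
        · simp [ha]
      rw [h1, h2, h3, h4]
      cases x e <;> simp

/-- The Frobenius relation: `Δ(X a)` is `Δ(a)` multiplied by `X` in either factor. -/
theorem edge_mulX_split {r r' : Setoid A} {u v : A} (h : r'.IsMerge r u v) (e : A) :
    ∀ w ∈ constVec r, edge r r' u v (mulX r e w) = mulX r' e (edge r r' u v w) := by
  refine eqOn_constVec (f := edge r r' u v ∘ₗ mulX r e) (g := mulX r' e ∘ₗ edge r r' u v)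
    fun x hx => ?_
  have hL := h.rel_left_iff
  have huv := h.not_rel
  rw [LinearMap.comp_apply, LinearMap.comp_apply, edge_split h hx, mulX_single,
    apply_ite (edge r r' u v), map_zero, edge_split h (hx.lower e), apply_ite (mulX r' e),
    map_add, mulX_single, mulX_single, mulX_single]
  by_cases hu : r u e
  · have hxe : x e = x u := (hx u e hu).symm
    have hre : ∀ a, r e a ↔ r' u a ∨ r' v a := fun a => by
      rw [← hL]; exact ⟨r.trans hu, r.trans (r.symm hu)⟩
    have h2 : lower r e x u = false := by simp [lower, r.symm hu]
    rw [h2, hxe]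
    -- Of the two terms of `Δ(1)`, the one already lowered at the half of `e` is killed by `X² = 0`;
    -- the other becomes `X ⊗ X`.
    rcases (hL e).1 hu with h3 | h3
    · have h4 : lower r' u x e = false := by simp [lower, h3]
      have h5 : ¬ r' v e := fun h' => huv (r'.trans h3 (r'.symm h'))
      have h6 : lower r' v x e = x u := by simp [lower, h5, hxe]
      have h7 : lower r' e (lower r' v x) = lower r e x := by
        funext a
        have : r' e a ↔ r' u a := ⟨r'.trans h3, r'.trans (r'.symm h3)⟩
        simp only [lower, hre, this]
        split_ifs <;> tauto
      rw [h4, h6, h7]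
      cases x u <;> simp
    · have h4 : lower r' v x e = false := by simp [lower, h3]
      have h5 : ¬ r' u e := fun h' => huv (r'.trans h' (r'.symm h3))
      have h6 : lower r' u x e = x u := by simp [lower, h5, hxe]
      have h7 : lower r' e (lower r' u x) = lower r e x := by
        funext a
        have : r' e a ↔ r' v a := ⟨r'.trans h3, r'.trans (r'.symm h3)⟩
        simp only [lower, hre, this]
        split_ifs <;> tauto
      rw [h4, h6, h7]
      cases x u <;> simp
  · have hue : ¬ r e u := fun h' => hu (r.symm h')
    have h1 : ¬ r' u e := fun h' => hu ((hL e).2 (Or.inl h'))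
    have h2 : ¬ r' v e := fun h' => hu ((hL e).2 (Or.inr h'))
    have h3 : lower r e x u = x u := by simp [lower, hue]
    have h4 : lower r' u x e = x e := by simp [lower, h1]
    have h5 : lower r' v x e = x e := by simp [lower, h2]
    have h6 : ∀ a, r e a ↔ r' e a := h.rel_iff_of_not h1 h2
    have h7 : ∀ y, lower r e y = lower r' e y := fun y => by funext a; simp only [lower, h6]
    have h8 : ∀ w, lower r' w (lower r' e x) = lower r' e (lower r' w x) := fun w => by
      funext a; simp only [lower]; split_ifs <;> rfl
    rw [h3, h4, h5, h7, h8, h8]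
    cases x u <;> cases x e <;> simp

/-- `r'` arises from `r` by merging two classes or by splitting a class. -/
def IsEdge (r r' : Setoid A) (u v : A) : Prop := r.IsMerge r' u v ∨ r'.IsMerge r u v

theorem IsEdge.edge_mulX {r r' : Setoid A} {u v : A} (h : IsEdge r r' u v) (e : A) :
    ∀ w ∈ constVec r, edge r r' u v (mulX r e w) = mulX r' e (edge r r' u v w) :=
  h.elim (fun h => edge_mulX_merge h e) fun h => edge_mulX_split h e

theorem edge_unit_merge {r r' : Setoid A} {u v : A} (h : r.IsMerge r' u v) :
    edge r r' u v (unit A) = unit A := by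
  rw [unit, edge_merge h (fun _ _ _ => rfl)]
  have : merged r' u v (fun _ => true) = fun _ => true := by funext a; simp [merged]
  simp [this]

theorem edge_unit_split {r r' : Setoid A} {u v : A} (h : r'.IsMerge r u v) :
    edge r r' u v (unit A) = mulX r' u (unit A) + mulX r' v (unit A) := by
  rw [unit, edge_split h (fun _ _ _ => rfl)]
  simp [mulX_single]

/-- Two maps which agree on the unit and are compatible with the multiplications agree. -/
theorem eqOn_of_unit {r r' : Setoid A} {f g : Vec A →ₗ[ℤ] Vec A}
    (hf : ∀ e, ∀ w ∈ constVec r, f (mulX r e w) = mulX r' e (f w))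
    (hg : ∀ e, ∀ w ∈ constVec r, g (mulX r e w) = mulX r' e (g w))
    (h1 : f (unit A) = g (unit A)) : ∀ w ∈ constVec r, f w = g w := by
  refine eqOn_constVec fun x hx => ?_
  -- Induction on the number of points labelled `-`: raising the class of such a point `e` gives `y`
  -- with `x = X_e · y`.
  obtain ⟨m, hm⟩ : ∃ m, (Finset.univ.filter fun a => x a = false).card = m := ⟨_, rfl⟩
  induction m using Nat.strong_induction_on generalizing x with
  | _ m ih =>
    by_cases hx1 : ∃ e, x e = false
    · obtain ⟨e, he⟩ := hx1
      let y : A → Bool := fun a => if r e a then true else x a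
      have hy : IsConst r y := by
        intro a b hab
        have : r e a ↔ r e b := ⟨fun h => r.trans h hab, fun h => r.trans h (r.symm hab)⟩
        simp only [y, this, hx a b hab]
      have hyx : lower r e y = x := by
        funext a
        simp only [lower, y]
        split_ifs with h
        · rw [← hx e a h, he]
        · rfl
      have hye : y e = true := by simp [y]
      have hxy : Finsupp.single x (1 : ℤ) = mulX r e (Finsupp.single y 1) := by
        rw [mulX_single, if_pos hye, hyx]
      have hlt : (Finset.univ.filter fun a => y a = false).card < m := by
        rw [← hm]
        refine Finset.card_lt_card (Finset.ssubset_iff_of_subset ?_ |>.2 ⟨e, ?_, ?_⟩)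
        · intro a
          simp only [Finset.mem_filter, Finset.mem_univ, true_and, y]
          split_ifs <;> simp
        · simp [he]
        · simp [hye]
      rw [hxy, hf e _ (single_mem_constVec hy 1), hg e _ (single_mem_constVec hy 1),
        ih _ hlt y hy rfl]
    · have : x = fun _ => true := by
        funext a
        by_contra h
        exact hx1 ⟨a, by simpa using h⟩
      rw [this]
      exact h1

/-- The two ways around a square of the cube of resolutions agree. -/
theorem edge_comm {r₀ r₁ r₂ r₃ : Setoid A} {u v s t : A} (h01 : IsEdge r₀ r₁ u v)
    (h02 : IsEdge r₀ r₂ s t) (h13 : IsEdge r₁ r₃ s t) (h23 : IsEdge r₂ r₃ u v) :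
    ∀ w ∈ constVec r₀, edge r₁ r₃ s t (edge r₀ r₁ u v w) = edge r₂ r₃ u v (edge r₀ r₂ s t w) := by
  refine eqOn_of_unit (r' := r₃) (f := edge r₁ r₃ s t ∘ₗ edge r₀ r₁ u v)
    (g := edge r₂ r₃ u v ∘ₗ edge r₀ r₂ s t) (fun e w hw => ?_) (fun e w hw => ?_) ?_
  · simp only [LinearMap.comp_apply]
    rw [h01.edge_mulX e w hw, h13.edge_mulX e _ (edge_mem _ _ _ _ _)]
  · simp only [LinearMap.comp_apply]
    rw [h02.edge_mulX e w hw, h23.edge_mulX e _ (edge_mem _ _ _ _ _)]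
  have hX : ∀ {r r' : Setoid A} {a b : A}, IsEdge r r' a b → ∀ c d,
      edge r r' a b (mulX r c (unit A) + mulX r d (unit A)) =
        mulX r' c (edge r r' a b (unit A)) + mulX r' d (edge r r' a b (unit A)) := by
    intro r r' a b h c d
    rw [map_add, h.edge_mulX c _ (unit_mem r), h.edge_mulX d _ (unit_mem r)]
  have hcongr : ∀ a b, r₃ a b → mulX r₃ a (unit A) = mulX r₃ b (unit A) :=
    fun a b hab => mulX_congr hab _ (unit_mem r₃)
  simp only [LinearMap.comp_apply]
  -- Of the sixteen merge/split patterns, six have the same change in the number of classes along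
  -- both routes.
  rcases h01 with a | a <;> rcases h02 with b | b <;> rcases h13 with c | c <;>
    rcases h23 with d | d <;>
    first
    | (exfalso; have := a.card_eq; have := b.card_eq; have := c.card_eq; have := d.card_eq; omega)
    | skip
  · rw [edge_unit_merge a, edge_unit_merge b, edge_unit_merge c, edge_unit_merge d]
  · rw [edge_unit_merge a, edge_unit_merge b, edge_unit_split c, edge_unit_split d]
    -- Merge, then split: `s`, `t` and `u`, `v` represent the same two classes of `r₃`, so both
    -- values are the same `Δ(1)`.
    rcases c.rel_or_rel d.not_rel a.rel with ⟨h1, h2⟩ | ⟨h1, h2⟩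
    · rw [hcongr u s h1, hcongr v t h2]
    · rw [hcongr u t h1, hcongr v s h2, add_comm]
  · rw [edge_unit_merge a, edge_unit_split b, edge_unit_split c, hX (Or.inl d),
      edge_unit_merge d]
  · rw [edge_unit_split a, edge_unit_merge b, edge_unit_split d, hX (Or.inl c),
      edge_unit_merge c]
  · rw [edge_unit_split a, edge_unit_split b, hX (Or.inl c), hX (Or.inl d), edge_unit_merge c,
      edge_unit_merge d]
    -- Split, then merge: all four points lie in one class of `r₃`, and both values are `2X` there.
    have huv : r₃ u v := d.rel
    have hst : r₃ s t := c.rel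
    have hus : r₃ u s := by
      rcases a.rel_or_rel c.not_rel b.rel with ⟨h1, -⟩ | ⟨h1, -⟩
      · exact r₃.symm (c.le h1)
      · exact r₃.trans huv (r₃.symm (c.le h1))
    rw [← hcongr u v huv, ← hcongr s t hst, hcongr u s hus]
  · rw [edge_unit_split a, edge_unit_split b, hX (Or.inr c), hX (Or.inr d), edge_unit_split c,
      edge_unit_split d]
    simp only [map_add]
    rw [mulX_comm r₃ s u, mulX_comm r₃ s v, mulX_comm r₃ t u, mulX_comm r₃ t v]
    abel

end Labelling

/-! ### The spectral sequence of a filtered complex -/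

universe u

/-- The first isomorphism theorem for a surjective map with a given kernel. -/
noncomputable def LinearMap.quotientEquivOfSurjective {R M N : Type*} [CommRing R]
    [AddCommGroup M] [Module R M] [AddCommGroup N] [Module R N] (f : M →ₗ[R] N)
    (hf : Function.Surjective f) {K : Submodule R M} (hK : LinearMap.ker f = K) : (M ⧸ K) ≃ₗ[R] N :=
  (Submodule.quotEquivOfEq _ _ hK.symm).trans (f.quotKerEquivOfSurjective hf)

/-- Homology may be presented by any module mapping onto the cycles. This allows page `r + 1` to be
compared with `Z (r + 1)` directly instead of through a subquotient of a subquotient. -/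
theorem CategoryTheory.ShortComplex.nonempty_homology_iso_quotient {𝕜 : Type u} [CommRing 𝕜]
    (S : ShortComplex (ModuleCat.{u} 𝕜)) {N : Type u} [AddCommGroup N] [Module 𝕜 N]
    (φ : N →ₗ[𝕜] S.X₂) (hφ : ∀ z, S.g.hom (φ z) = 0) (hs : ∀ m, S.g.hom m = 0 → ∃ z, φ z = m)
    (K : Submodule 𝕜 N) (hK : ∀ z, z ∈ K ↔ ∃ y, S.f.hom y = φ z) :
    Nonempty (S.homology ≅ ModuleCat.of 𝕜 (N ⧸ K)) := by
  let ψ : N →ₗ[𝕜] LinearMap.ker S.g.hom ⧸ LinearMap.range S.moduleCatToCycles :=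
    (LinearMap.range S.moduleCatToCycles).mkQ ∘ₗ φ.codRestrict (LinearMap.ker S.g.hom) hφ
  have hsurj : Function.Surjective ψ := by
    intro m
    obtain ⟨⟨m, hm⟩, rfl⟩ := Submodule.mkQ_surjective _ m
    obtain ⟨z, rfl⟩ := hs m hm
    exact ⟨z, rfl⟩
  have hker : LinearMap.ker ψ = K := by
    ext z
    rw [hK, LinearMap.mem_ker]
    change (Submodule.Quotient.mk _ : _ ⧸ LinearMap.range S.moduleCatToCycles) = 0 ↔ _
    rw [Submodule.Quotient.mk_eq_zero]
    constructor
    · rintro ⟨y, hy⟩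
      exact ⟨y, congrArg Subtype.val hy⟩
    · rintro ⟨y, hy⟩
      exact ⟨y, Subtype.ext hy⟩
  exact ⟨S.moduleCatHomologyIso ≪≫
    (ψ.quotientEquivOfSurjective hsurj hker).symm.toModuleIso⟩

/-- A filtered complex of modules, with a differential of degree `1`. -/
structure FilteredComplex (𝕜 : Type u) [CommRing 𝕜] (C : ℤ → Type u) [∀ i, AddCommGroup (C i)]
    [∀ i, Module 𝕜 (C i)] where
  /-- the differential -/
  d : ∀ i i', C i →ₗ[𝕜] C i'
  d_comp : ∀ i i' i'', d i' i'' ∘ₗ d i i' = 0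
  /-- the filtration -/
  F : ∀ i, ℤ → Submodule 𝕜 (C i)
  mono : ∀ i, Monotone (F i)
  d_mem : ∀ i i' p x, x ∈ F i p → d i i' x ∈ F i' p

namespace FilteredComplex

variable {𝕜 : Type u} [CommRing 𝕜] {C : ℤ → Type u} [∀ i, AddCommGroup (C i)]
  [∀ i, Module 𝕜 (C i)] (K : FilteredComplex 𝕜 C)

/-- The elements of filtration degree `p` whose differential has filtration degree `p - r`. -/
def Z (r p i : ℤ) : Submodule 𝕜 (C i) := K.F i p ⊓ (K.F (i + 1) (p - r)).comap (K.d i (i + 1))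

/-- The elements of `Z r p i` which vanish on the page `r`. -/
def B (r p i : ℤ) : Submodule 𝕜 (C i) :=
  K.Z (r - 1) (p - 1) i ⊔ (K.F i p ⊓ (K.F (i - 1) (p + r - 1)).map (K.d (i - 1) i))

/-- The terms of the spectral sequence. -/
abbrev E (r p i : ℤ) : Type u := SubQuotient (K.Z r p i) (K.B r p i)

theorem d_d (i i' i'' : ℤ) (x : C i) : K.d i' i'' (K.d i i' x) = 0 :=
  LinearMap.congr_fun (K.d_comp i i' i'') x

/-- The degrees enter through equations, so that indices such as `i - 1 + 1` and `i` can be matched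
without transporting elements. -/
theorem mem_Z {r p i i' q : ℤ} (h : i + 1 = i') (hq : p - r = q) {x : C i} :
    x ∈ K.Z r p i ↔ x ∈ K.F i p ∧ K.d i i' x ∈ K.F i' q := by
  subst h hq
  rfl

theorem mem_B {r p i i' q : ℤ} (h : i' + 1 = i) (hq : p + r - 1 = q) {x : C i} :
    x ∈ K.B r p i ↔ ∃ a ∈ K.Z (r - 1) (p - 1) i, ∃ y ∈ K.F i' q,
      K.d i' i y ∈ K.F i p ∧ a + K.d i' i y = x := by
  obtain rfl : i' = i - 1 := by omega
  subst hq
  rw [B, Submodule.mem_sup]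
  constructor
  · rintro ⟨a, ha, _, ⟨hb, y, hy, rfl⟩, rfl⟩
    exact ⟨a, ha, y, hy, hb, rfl⟩
  · rintro ⟨a, ha, y, hy, hb, rfl⟩
    exact ⟨a, ha, _, ⟨hb, y, hy, rfl⟩, rfl⟩

theorem Z_le_Z {r r' p i : ℤ} (h : r ≤ r') : K.Z r' p i ≤ K.Z r p i :=
  inf_le_inf le_rfl (Submodule.comap_mono (K.mono _ (by omega)))

theorem d_mem_Z {r r' p i q i' : ℤ} (h : p - r = q) (hi : i + 1 = i') {x : C i}
    (hx : x ∈ K.Z r p i) : K.d i i' x ∈ K.Z r' q i' := by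
  rw [K.mem_Z hi h] at hx
  rw [K.mem_Z rfl rfl, K.d_d]
  exact ⟨hx.2, zero_mem _⟩

/-- The boundary half of `B` is killed by `d`; the other half, of filtration degree `p - 1 = q + r -
1`, is sent into the boundary half at `q`. -/
theorem d_mem_B {r p i q i' : ℤ} (h : p - r = q) (hi : i + 1 = i') {x : C i}
    (hx : x ∈ K.B r p i) : K.d i i' x ∈ K.B r q i' := by
  obtain ⟨a, ha, y, -, -, rfl⟩ := (K.mem_B (sub_add_cancel i 1) rfl).1 hx
  rw [map_add, K.d_d, add_zero, K.mem_B hi rfl]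
  rw [K.mem_Z hi rfl] at ha
  refine ⟨0, zero_mem _, a, ?_, ?_, zero_add _⟩
  · convert ha.1 using 1; congr 1; omega
  · convert ha.2 using 1; congr 1; omega

/-- The differentials of the spectral sequence. -/
def dE {r p i q i' : ℤ} (h : p - r = q) (hi : i + 1 = i') : K.E r p i →ₗ[𝕜] K.E r q i' :=
  Submodule.mapQ _ _ ((K.d i i').restrict fun _ hx => K.d_mem_Z h hi hx)
    fun _ hx => K.d_mem_B h hi hx

theorem mk_eq_zero_iff {r p i : ℤ} (x : K.Z r p i) :
    (Submodule.Quotient.mk x : K.E r p i) = 0 ↔ (x : C i) ∈ K.B r p i := by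
  rw [Submodule.Quotient.mk_eq_zero]
  rfl

theorem dE_mk {r p i q i' : ℤ} (h : p - r = q) (hi : i + 1 = i') (x : K.Z r p i) :
    K.dE h hi (Submodule.Quotient.mk x) =
      Submodule.Quotient.mk ⟨K.d i i' x, K.d_mem_Z h hi x.2⟩ := rfl

theorem rel_iff {r : ℤ} {a b : ℤ × ℤ} :
    (ComplexShape.up' ((-r, 1) : ℤ × ℤ)).Rel a b ↔ a.1 - r = b.1 ∧ a.2 + 1 = b.2 := by
  change a + (-r, 1) = b ↔ _
  rw [Prod.ext_iff, Prod.fst_add, Prod.snd_add, sub_eq_add_neg]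

open Classical in
/-- The pages of the spectral sequence. -/
noncomputable def page (r : ℤ) :
    HomologicalComplex (ModuleCat.{u} 𝕜) (ComplexShape.up' ((-r, 1) : ℤ × ℤ)) where
  X a := ModuleCat.of 𝕜 (K.E r a.1 a.2)
  d a b := if h : a.1 - r = b.1 ∧ a.2 + 1 = b.2 then ModuleCat.ofHom (K.dE h.1 h.2) else 0
  shape a b h := dif_neg fun h' => h (rel_iff.2 h')
  d_comp_d' a b c hab hbc := by
    have hab' := rel_iff.1 hab
    have hbc' := rel_iff.1 hbc
    rw [dif_pos hab', dif_pos hbc']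
    ext x
    change K.dE hbc'.1 hbc'.2 (K.dE hab'.1 hab'.2 (Submodule.Quotient.mk x)) = 0
    rw [dE_mk, dE_mk, mk_eq_zero_iff]
    dsimp only
    rw [K.d_d]
    exact zero_mem _

theorem page_d {r : ℤ} {a b : ℤ × ℤ} (h : a.1 - r = b.1) (hi : a.2 + 1 = b.2) :
    (K.page r).d a b = ModuleCat.ofHom (K.dE h hi) := dif_pos ⟨h, hi⟩

/-- The projection from `Z (r + 1) p i` to the page `r`. -/
def toE (r p i : ℤ) : K.Z (r + 1) p i →ₗ[𝕜] K.E r p i :=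
  Submodule.mkQ _ ∘ₗ Submodule.inclusion (K.Z_le_Z (by omega))

theorem toE_apply (r p i : ℤ) (x : K.Z (r + 1) p i) :
    K.toE r p i x = Submodule.Quotient.mk ⟨x, K.Z_le_Z (by omega) x.2⟩ := rfl

/-- A class on page `r` is a cycle exactly when some representative lies in `Z (r + 1)`, and such a
representative gives a boundary exactly when it lies in `B (r + 1)`. -/
theorem nonempty_page_iso (r : ℤ) (a : ℤ × ℤ) :
    Nonempty ((K.page r).homology a ≅ (K.page (r + 1)).X a) := by
  obtain ⟨p, i⟩ := a
  have hprev : (ComplexShape.up' ((-r, 1) : ℤ × ℤ)).prev (p, i) = (p + r, i - 1) :=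
    ComplexShape.prev_eq' _ (rel_iff.2 ⟨by simp, by simp⟩)
  have hnext : (ComplexShape.up' ((-r, 1) : ℤ × ℤ)).next (p, i) = (p - r, i + 1) :=
    ComplexShape.next_eq' _ (rel_iff.2 ⟨by simp, by simp⟩)
  have hf : ((K.page r).sc' (p + r, i - 1) (p, i) (p - r, i + 1)).f =
      ModuleCat.ofHom (K.dE (by simp) (by simp)) := K.page_d (by simp) (by simp)
  have hg : ((K.page r).sc' (p + r, i - 1) (p, i) (p - r, i + 1)).g =
      ModuleCat.ofHom (K.dE rfl rfl) := K.page_d rfl rfl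
  obtain ⟨e⟩ := CategoryTheory.ShortComplex.nonempty_homology_iso_quotient
    ((K.page r).sc' (p + r, i - 1) (p, i) (p - r, i + 1)) (K.toE r p i) (by
      intro z
      rw [hg]
      change K.dE rfl rfl (K.toE r p i z) = 0
      rw [toE_apply, dE_mk, mk_eq_zero_iff]
      have hz := (K.mem_Z rfl rfl).1 z.2
      -- The extra drop in filtration puts `d z` in the `Z (r - 1)` half of `B`, with no boundary
      -- term needed.
      refine (K.mem_B rfl rfl).2 ⟨K.d i (i + 1) z, (K.mem_Z rfl rfl).2 ⟨?_, ?_⟩, 0, zero_mem _,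
        ?_, ?_⟩
      · convert hz.2 using 2; omega
      · rw [K.d_d]; exact zero_mem _
      · rw [map_zero]; exact zero_mem _
      · rw [map_zero, add_zero]) (by
      intro m hm
      rw [hg] at hm
      obtain ⟨m, rfl⟩ : ∃ x : K.Z r p i, (Submodule.Quotient.mk x : K.E r p i) = m :=
        Submodule.Quotient.mk_surjective _ m
      change K.dE rfl rfl (Submodule.Quotient.mk m) = 0 at hm
      rw [dE_mk, mk_eq_zero_iff, K.mem_B rfl rfl] at hm
      obtain ⟨w, hw, y, hy, hdy, hwy⟩ := hm
      dsimp only at hwy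
      have hm := (K.mem_Z rfl rfl).1 m.2
      have hy' : y ∈ K.F i (p - 1) := by convert hy using 2; omega
      -- Since `d m = w + d y` with `w` one filtration step lower, subtracting `y` improves `m` to
      -- an element of `Z (r + 1)` without changing its class.
      have hz : (m : C i) - y ∈ K.Z (r + 1) p i := by
        refine (K.mem_Z rfl rfl).2 ⟨sub_mem hm.1 (K.mono i (by omega) hy'), ?_⟩
        rw [map_sub, ← hwy, add_sub_cancel_right]
        have := ((K.mem_Z rfl rfl).1 hw).1
        convert this using 2; omega
      refine ⟨⟨_, hz⟩, ?_⟩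
      change K.toE r p i _ = (Submodule.Quotient.mk m : K.E r p i)
      rw [toE_apply, eq_comm, Submodule.Quotient.eq]
      refine (K.mem_B (sub_add_cancel i 1) rfl).2 ⟨y, (K.mem_Z rfl rfl).2 ⟨hy', ?_⟩, 0,
        zero_mem _, ?_, ?_⟩
      · convert hdy using 2; omega
      · rw [map_zero]; exact zero_mem _
      · rw [map_zero, add_zero]; simp)
    ((K.B (r + 1) p i).submoduleOf (K.Z (r + 1) p i)) (by
      intro z
      rw [hf]
      change (z : C i) ∈ K.B (r + 1) p i ↔ 
        ∃ y, K.dE (add_sub_cancel_right p r) (sub_add_cancel i 1) y = K.toE r p i z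
      constructor
      · intro hz
        obtain ⟨a, ha, y, hy, hdy, hay⟩ := (K.mem_B (sub_add_cancel i 1) rfl).1 hz
        have hyZ : y ∈ K.Z r (p + r) (i - 1) := by
          refine (K.mem_Z (sub_add_cancel i 1) (add_sub_cancel_right p r)).2 ⟨?_, hdy⟩
          convert hy using 2; omega
        refine ⟨Submodule.Quotient.mk ⟨y, hyZ⟩, ?_⟩
        rw [dE_mk, toE_apply, eq_comm, Submodule.Quotient.eq]
        refine (K.mem_B (sub_add_cancel i 1) rfl).2 ⟨a, ?_, 0, zero_mem _, ?_, ?_⟩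
        · exact K.Z_le_Z (by omega) ha
        · rw [map_zero]; exact zero_mem _
        · rw [map_zero, add_zero]
          change a = (z : C i) - K.d (i - 1) i y
          rw [← hay, add_sub_cancel_right]
      · rintro ⟨y, hy⟩
        obtain ⟨y, rfl⟩ := Submodule.Quotient.mk_surjective _ y
        rw [dE_mk, toE_apply, eq_comm, Submodule.Quotient.eq] at hy
        obtain ⟨a, ha, y', hy', hdy', hay⟩ := (K.mem_B (sub_add_cancel i 1) rfl).1 hy
        change a + K.d (i - 1) i y' = (z : C i) - K.d (i - 1) i y at hay
        have hy := (K.mem_Z (sub_add_cancel i 1) (add_sub_cancel_right p r)).1 y.2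
        have hz := (K.mem_Z rfl rfl).1 z.2
        -- The bounding chains `y'` of degree `p + r - 1` and `y` of degree `p + r` combine, as `p +
        -- (r + 1) - 1 = p + r`. The remainder `a` has the same differential as `z`, which gives it
        -- the required drop.
        refine (K.mem_B (sub_add_cancel i 1) (q := p + r) (by omega)).2
          ⟨a, (K.mem_Z rfl rfl).2 ⟨((K.mem_Z rfl rfl).1 ha).1, ?_⟩, y' + y, ?_, ?_, ?_⟩
        · have : K.d i (i + 1) a = K.d i (i + 1) z := by
            rw [eq_sub_iff_add_eq] at hay
            rw [← hay, map_add, map_add, K.d_d, K.d_d, add_zero, add_zero]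
          rw [this]
          convert hz.2 using 2; omega
        · exact add_mem (K.mono _ (by omega) hy') hy.1
        · rw [map_add]; exact add_mem hdy' hy.2
        · rw [map_add, ← add_assoc, hay, sub_add_cancel])
  exact ⟨(K.page r).homologyIsoSc' _ _ _ hprev hnext ≪≫ e⟩

/-- The spectral sequence of a filtered complex. -/
noncomputable def spectralSequence : FiltrationSpectralSequence 𝕜 where
  page r _ := K.page r
  iso r r' a hrr' _ := by
    subst hrr'
    exact (K.nonempty_page_iso r a).some

/-- The homology of the complex. -/
abbrev H (i : ℤ) : Type u := HomologyAt (K.d (i - 1) i) (K.d i (i + 1))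

/-- The induced filtration of the homology. -/
def FH (i p : ℤ) : Submodule 𝕜 (K.H i) :=
  ((K.F i p).submoduleOf (LinearMap.ker (K.d i (i + 1)))).map (Submodule.mkQ _)

theorem FH_mono (i : ℤ) : Monotone (K.FH i) := fun _ _ h =>
  Submodule.map_mono (Submodule.comap_mono (K.mono i h))

/-- The stable terms of the spectral sequence. -/
theorem nonempty_E_iso {r p i : ℤ} (h1 : K.F (i + 1) (p - r) = ⊥)
    (h3 : K.F (i - 1) (p + r - 1) = ⊤) :
    Nonempty (K.E r p i ≃ₗ[𝕜] SubQuotient (K.FH i p) (K.FH i (p - 1))) := by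
  -- The step `p - r` of the filtration is zero, so approximate cycles are cycles.
  have hker : ∀ x : K.Z r p i, (x : C i) ∈ LinearMap.ker (K.d i (i + 1)) := fun x => by
    have := ((K.mem_Z rfl rfl).1 x.2).2
    rwa [h1, Submodule.mem_bot] at this
  let φ₁ : K.Z r p i →ₗ[𝕜] K.H i := Submodule.mkQ _ ∘ₗ
    (K.Z r p i).subtype.codRestrict (LinearMap.ker (K.d i (i + 1))) hker
  let φ₂ : K.Z r p i →ₗ[𝕜] K.FH i p := φ₁.codRestrict (K.FH i p) fun x =>
    ⟨_, ((K.mem_Z rfl rfl).1 x.2).1, rfl⟩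
  let φ : K.Z r p i →ₗ[𝕜] SubQuotient (K.FH i p) (K.FH i (p - 1)) := Submodule.mkQ _ ∘ₗ φ₂
  have hsurj : Function.Surjective φ := by
    intro y
    obtain ⟨⟨y, x, hx, rfl⟩, rfl⟩ := Submodule.mkQ_surjective _ y
    have hx0 : K.d i (i + 1) x = 0 := x.2
    exact ⟨⟨x, (K.mem_Z rfl rfl).2 ⟨hx, by rw [hx0]; exact zero_mem _⟩⟩, rfl⟩
  have hk : LinearMap.ker φ = (K.B r p i).submoduleOf (K.Z r p i) := by
    ext x
    rw [LinearMap.mem_ker]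
    change (Submodule.Quotient.mk (φ₂ x) : SubQuotient (K.FH i p) (K.FH i (p - 1))) = 0 ↔
      (x : C i) ∈ K.B r p i
    rw [Submodule.Quotient.mk_eq_zero, K.mem_B (sub_add_cancel i 1) rfl]
    change φ₁ x ∈ K.FH i (p - 1) ↔ _
    have hx := (K.mem_Z rfl rfl).1 x.2
    constructor
    -- The chain bounding `x - a` is an arbitrary one; it is admissible in `B` because step `p + r -
    -- 1` is everything.
    · rintro ⟨a, ha, hax⟩
      have := (Submodule.Quotient.eq _).1 hax.symm
      obtain ⟨y, hy⟩ := this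
      change K.d (i - 1) i y = (x : C i) - (a : C i) at hy
      have ha0 : K.d i (i + 1) a = 0 := a.2
      refine ⟨a, (K.mem_Z rfl rfl).2 ⟨ha, by rw [ha0]; exact zero_mem _⟩, y, ?_, ?_, ?_⟩
      · rw [h3]; trivial
      · rw [hy]; exact sub_mem hx.1 (K.mono i (by omega) ha)
      · rw [hy, add_sub_cancel]
    · rintro ⟨a, ha, y, -, -, hay⟩
      have ha' := (K.mem_Z rfl rfl).1 ha
      have ha0 : K.d i (i + 1) a = 0 := by
        have h0 : K.d i (i + 1) x = 0 := hker x
        rw [← hay, map_add, K.d_d, add_zero] at h0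
        exact h0
      refine ⟨⟨a, ha0⟩, ha'.1, Eq.symm ((Submodule.Quotient.eq _).2 ⟨y, ?_⟩)⟩
      change K.d (i - 1) i y = (x : C i) - a
      rw [← hay, add_sub_cancel_left]
  exact ⟨φ.quotientEquivOfSurjective hsurj hk⟩

/-- The spectral sequence of a bounded filtration converges. -/
theorem convergesTo {N : ℤ} (hbot : ∀ i, ∀ p ≤ -N, K.F i p = ⊥) (htop : ∀ i, ∀ p ≥ N, K.F i p = ⊤) :
    K.spectralSequence.ConvergesTo K.H K.FH := by
  refine ⟨fun i => ⟨K.FH_mono i, ⟨-N, ?_⟩, ⟨N, ?_⟩⟩, fun p i => ?_⟩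
  · rw [FH, hbot i _ le_rfl]
    refine (Submodule.eq_bot_iff _).2 ?_
    rintro _ ⟨x, hx, rfl⟩
    have : x = 0 := Subtype.ext hx
    rw [this, map_zero]
  · rw [FH, htop i _ le_rfl]
    refine Submodule.eq_top_iff'.2 fun x => ?_
    obtain ⟨x, rfl⟩ := Submodule.mkQ_surjective _ x
    exact ⟨x, trivial, rfl⟩
  -- Beyond this bound `p - r ≤ -N` and `p + r - 1 ≥ N`.
  · refine ⟨|p| + |N| + 1, by have := abs_nonneg p; have := abs_nonneg N; omega, fun r hr hr1 => ?_⟩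
    have := le_abs_self p; have := neg_abs_le p; have := le_abs_self N; have := neg_abs_le N
    have hzero : ∀ q i' : ℤ, q ≤ -N → ∀ z : K.E r q i', z = 0 := by
      intro q i' hq z
      obtain ⟨z, rfl⟩ := Submodule.Quotient.mk_surjective _ z
      have hz := ((K.mem_Z rfl rfl).1 z.2).1
      rw [hbot _ _ hq, Submodule.mem_bot] at hz
      rw [mk_eq_zero_iff, hz]
      exact zero_mem _
    refine ⟨?_, ?_, ?_⟩
    · change (K.page r).d _ _ = 0
      rw [K.page_d (a := (p, i)) (b := (p - r, i + 1)) rfl rfl]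
      ext x
      exact hzero (p - r) (i + 1) (by omega) _
    · change (K.page r).d _ _ = 0
      rw [K.page_d (a := (p + r, i - 1)) (b := (p, i)) (add_sub_cancel_right p r)
        (sub_add_cancel i 1)]
      ext x
      change K.dE (add_sub_cancel_right p r) (sub_add_cancel i 1) (Submodule.Quotient.mk x) = 0
      rw [dE_mk, mk_eq_zero_iff]
      -- The incoming differential vanishes although its source need not: `x` already lies in step
      -- `p + r - 1`, so `d x` belongs to `B`.
      refine (K.mem_B (sub_add_cancel i 1) rfl).2 ⟨0, zero_mem _, x, ?_, ?_, zero_add _⟩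
      · rw [htop _ _ (by omega)]; trivial
      · exact ((K.mem_Z (sub_add_cancel i 1) (add_sub_cancel_right p r)).1 x.2).2
    · obtain ⟨e⟩ := K.nonempty_E_iso (r := r) (p := p) (i := i) (hbot _ _ (by omega))
        (htop _ _ (by omega))
      exact ⟨e.toModuleIso⟩

end FilteredComplex

/-! ### Region functions of a planar diagram -/

namespace CrossingGraph

variable (G : CrossingGraph)

open Classical in
/-- The incidence matrix modulo `2` of crossings and edges. -/
noncomputable def incidence : Matrix (Fin G.crossings) G.Arc (ZMod 2) := fun c e =>
  ∑ s : Bool, ((if e = G.inArc c s then 1 else 0) + if e = G.outArc c s then 1 else 0)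

theorem incidence_mulVec (g : G.Arc → ZMod 2) (c : Fin G.crossings) :
    (G.incidence.mulVec g) c = ∑ s : Bool, (g (G.inArc c s) + g (G.outArc c s)) := by
  simp only [Matrix.mulVec, dotProduct, incidence, Fintype.sum_bool, add_mul, ite_mul, one_mul,
    zero_mul, Finset.sum_add_distrib, Finset.sum_ite_eq', Finset.mem_univ, if_true]

theorem incidence_transpose_mulVec (h : Fin G.crossings → ZMod 2) (x : Fin G.crossings × Bool) :
    (G.incidence.transpose.mulVec h) (Sum.inl x) = h (G.next x).1 + h x.1 := by
  have h1 : ∀ c s, (Sum.inl x : G.Arc) = G.inArc c s ↔ G.next x = (c, s) := fun c s => by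
    rw [inArc, Sum.inl.injEq, Equiv.eq_symm_apply]
  have h2 : ∀ c s, (Sum.inl x : G.Arc) = G.outArc c s ↔ x = (c, s) := fun c s => by
    rw [outArc, Sum.inl.injEq]
  have h3 : ∀ y : Fin G.crossings × Bool,
      ∑ c, ∑ s : Bool, (if y = (c, s) then (1 : ZMod 2) else 0) * h c = h y.1 := by
    intro y
    rw [← Fintype.sum_prod_type' (f := fun c s => (if y = (c, s) then (1 : ZMod 2) else 0) * h c)]
    simp
  simp only [Matrix.mulVec, dotProduct, incidence, Matrix.transpose_apply, Finset.sum_add_distrib,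
    add_mul, Finset.sum_mul, h1, h2, h3]

/-- A vector in this kernel is a function on crossings constant along edges. Together with arbitrary
values on the loops it descends to a function on the connected components of the diagram. -/
theorem finrank_ker_incidence_transpose_add_le :
    Module.finrank (ZMod 2) (LinearMap.ker G.incidence.transpose.mulVecLin) + G.loops ≤
      G.pieces := by
  classical
  have : Fintype (Quot G.Meet) := Fintype.ofFinite _
  have hker : ∀ h : LinearMap.ker G.incidence.transpose.mulVecLin, ∀ x,
      (h : Fin G.crossings → ZMod 2) (G.next x).1 = (h : Fin G.crossings → ZMod 2) x.1 := by
    intro h x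
    have h1 := congrFun h.2 (Sum.inl x)
    rw [Matrix.mulVecLin_apply, incidence_transpose_mulVec] at h1
    exact CharTwo.add_eq_zero.1 h1
  let Φ : (LinearMap.ker G.incidence.transpose.mulVecLin × (Fin G.loops → ZMod 2)) →ₗ[ZMod 2]
      (Quot G.Meet → ZMod 2) :=
    { toFun := fun p => Quot.lift (Sum.elim (fun x => (p.1 : Fin G.crossings → ZMod 2) x.1) p.2) (by
        rintro _ _ ⟨c, s, s', rfl, rfl⟩
        have := hker p.1 (G.next.symm (c, s))
        simpa [inArc, outArc] using this.symm)
      map_add' := by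
        intro p q
        funext e
        induction e using Quot.ind with
        | mk e => cases e <;> rfl
      map_smul' := by
        intro a p
        funext e
        induction e using Quot.ind with
        | mk e => cases e <;> rfl }
  have hΦ : Function.Injective Φ := by
    intro p q hpq
    refine Prod.ext (Subtype.ext (funext fun c => ?_)) (funext fun l => ?_)
    · exact congrFun hpq (Quot.mk _ (Sum.inl (c, false)))
    · exact congrFun hpq (Quot.mk _ (Sum.inr l))
  have := LinearMap.finrank_le_finrank_of_injective hΦ
  rw [Module.finrank_prod, Module.finrank_pi, Module.finrank_pi, Fintype.card_fin] at this
  rwa [pieces, Nat.card_eq_fintype_card]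

/-- Rank-nullity for the matrix and its transpose: with `V` crossings the nullity is `(2V + loops) -
V` plus that of the transpose. -/
theorem finrank_ker_incidence_le :
    Module.finrank (ZMod 2) (LinearMap.ker G.incidence.mulVecLin) ≤ G.crossings + G.pieces := by
  have h1 := LinearMap.finrank_range_add_finrank_ker G.incidence.mulVecLin
  have h2 := LinearMap.finrank_range_add_finrank_ker G.incidence.transpose.mulVecLin
  have h3 : Module.finrank (ZMod 2) (LinearMap.range G.incidence.transpose.mulVecLin) =
    Module.finrank (ZMod 2) (LinearMap.range G.incidence.mulVecLin) := Matrix.rank_transpose _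
  have h4 := G.finrank_ker_incidence_transpose_add_le
  have h5 : Fintype.card G.Arc = G.crossings * 2 + G.loops := by
    rw [Fintype.card_sum, Fintype.card_prod, Fintype.card_fin, Fintype.card_fin, Fintype.card_bool]
  rw [Module.finrank_pi, h5] at h1
  rw [Module.finrank_pi, Fintype.card_fin] at h2
  omega

end CrossingGraph

/-! ### Planarity: mod 2 cycles of edges bound -/

namespace LinkDiagram

open CrossingGraph

variable {n : ℕ} (D : LinkDiagram n)

/-- The coboundary modulo `2` of a function on the regions. -/
def coboundary : (Fin D.regions → ZMod 2) →ₗ[ZMod 2] (D.Arc → ZMod 2) where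
  toFun f e := f (D.left e) + f (D.right e)
  map_add' f g := by funext e; simp only [Pi.add_apply]; ring
  map_smul' a f := by funext e; simp only [Pi.smul_apply, smul_eq_mul, RingHom.id_apply]; ring

theorem coboundary_apply (f : Fin D.regions → ZMod 2) (e : D.Arc) :
    D.coboundary f e = f (D.left e) + f (D.right e) := rfl

theorem eq_outer_of_coboundary_eq_zero {f : Fin D.regions → ZMod 2} (hf : D.coboundary f = 0)
    (ρ : Fin D.regions) : f ρ = f D.outer := by
  have key : ∀ a b, Relation.EqvGen (fun a b => ∃ e, D.left e = a ∧ D.right e = b) a b →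
      f a = f b := fun a b h => by
    induction h with
    | rel a b h =>
      obtain ⟨e, rfl, rfl⟩ := h
      exact CharTwo.add_eq_zero.1 (congrFun hf e)
    | refl => rfl
    | symm _ _ _ ih => exact ih.symm
    | trans _ _ _ _ _ ih1 ih2 => exact ih1.trans ih2
  exact key _ _ (D.connected ρ D.outer)

/-- The vanishing of the first mod 2 cohomology of the sphere. Each corner region is counted twice
around a crossing, which gives one inclusion. By connectivity the image has dimension at least
`regions - 1`, which by Euler's formula bounds the dimension of the kernel. -/
theorem range_coboundary :
    LinearMap.range D.coboundary = LinearMap.ker D.incidence.mulVecLin := by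
  refine Submodule.eq_of_le_of_finrank_le ?_ ?_
  · rintro _ ⟨f, rfl⟩
    rw [LinearMap.mem_ker, Matrix.mulVecLin_apply]
    funext c
    rw [D.incidence_mulVec, Fintype.sum_bool]
    simp only [coboundary_apply, D.corner_front, D.corner_left, D.corner_back, D.corner_right,
      Pi.zero_apply]
    have : ∀ a b c d : ZMod 2, b + a + (d + c) + (d + b + (c + a)) = 0 := by decide
    rw [← this]
  · have h1 := LinearMap.finrank_range_add_finrank_ker D.coboundary
    rw [Module.finrank_pi, Fintype.card_fin] at h1
    have h2 : Module.finrank (ZMod 2) (LinearMap.ker D.coboundary) ≤ 1 := by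
      refine finrank_le_one (⟨fun _ => 1, ?_⟩) fun f => ⟨(f : Fin D.regions → ZMod 2) D.outer, ?_⟩
      · rw [LinearMap.mem_ker]
        funext e
        exact CharTwo.add_self_eq_zero 1
      · refine Subtype.ext (funext fun ρ => ?_)
        simpa using (D.eq_outer_of_coboundary_eq_zero f.2 ρ).symm
    have h3 := D.finrank_ker_incidence_le
    have h4 := D.euler
    omega

theorem exists_coboundary_eq {g : D.Arc → ZMod 2}
    (hg : ∀ c, ∑ s : Bool, (g (D.inArc c s) + g (D.outArc c s)) = 0) :
    ∃ f : Fin D.regions → ZMod 2, f D.outer = 0 ∧ D.coboundary f = g := by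
  have : g ∈ LinearMap.range D.coboundary := by
    rw [range_coboundary, LinearMap.mem_ker, Matrix.mulVecLin_apply]
    funext c
    rw [D.incidence_mulVec, hg, Pi.zero_apply]
  obtain ⟨f, rfl⟩ := this
  refine ⟨fun ρ => f ρ + f D.outer, CharTwo.add_self_eq_zero _, funext fun e => ?_⟩
  simp only [coboundary_apply]
  rw [add_add_add_comm, CharTwo.add_self_eq_zero, add_zero]

theorem eq_of_coboundary_eq {f f' : Fin D.regions → ZMod 2} (h : D.coboundary f = D.coboundary f')
    (h0 : f D.outer = f' D.outer) : f = f' := by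
  have h1 : D.coboundary (f - f') = 0 := by rw [map_sub, h, sub_self]
  funext ρ
  have := D.eq_outer_of_coboundary_eq_zero h1 ρ
  rw [Pi.sub_apply, Pi.sub_apply, h0, sub_self, sub_eq_zero] at this
  exact this

/-- A checkerboard colouring of the regions. -/
theorem exists_colouring : ∃ κ : Fin D.regions → Bool, ∀ e, κ (D.right e) = !κ (D.left e) := by
  -- All edges together form a cycle, as four edge ends meet at each crossing.
  obtain ⟨f, -, hf⟩ := D.exists_coboundary_eq (g := fun _ => 1) fun c => by
    rw [Fintype.sum_bool]; decide
  refine ⟨fun ρ => decide (f ρ = 1), fun e => ?_⟩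
  have := congrFun hf e
  rw [coboundary_apply] at this
  dsimp only
  revert this
  generalize f (D.left e) = a
  generalize f (D.right e) = b
  revert a b
  decide

end LinkDiagram

/-! ### The circles of a resolution -/

namespace CrossingGraph

variable (G : CrossingGraph)

/-- Two edges lie on the same circle of the resolution. -/
def circleRel (S : Fin G.crossings → Bool) : Setoid G.Arc := Setoid.ker (G.circle S)

theorem circle_surjective (S : Fin G.crossings → Bool) : Function.Surjective (G.circle S) :=
  Quot.mk_surjective

variable {G} in
theorem circle_eq_of_joined {S : Fin G.crossings → Bool} {e e' : G.Arc} (h : G.Joined S e e') :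
    G.circle S e = G.circle S e' := Quot.sound h

variable {G} in
theorem circleRel_le {S : Fin G.crossings → Bool} {r : Setoid G.Arc}
    (h : ∀ e e', G.Joined S e e' → r e e') : G.circleRel S ≤ r := by
  intro e e' hee
  have : Relation.EqvGen (G.Joined S) e e' := Quot.eqvGen_exact hee
  induction this with
  | rel _ _ h1 => exact h _ _ h1
  | refl => exact r.refl _
  | symm _ _ h1 ih => exact r.symm (ih (Quot.eqvGen_sound h1))
  | trans _ _ _ h1 h2 ih1 ih2 =>
    exact r.trans (ih1 (Quot.eqvGen_sound h1)) (ih2 (Quot.eqvGen_sound h2))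

section

variable {G} {S : Fin G.crossings → Bool} {c : Fin G.crossings}

theorem circle_inArc_eq_outArc (h : S c ≠ G.positive c) (s : Bool) :
    G.circle S (G.inArc c s) = G.circle S (G.outArc c (!s)) :=
  circle_eq_of_joined ⟨c, Or.inl ⟨h, s, rfl, rfl⟩⟩

theorem circle_inArc_eq_inArc (h : S c = G.positive c) (s s' : Bool) :
    G.circle S (G.inArc c s) = G.circle S (G.inArc c s') := by
  have : G.circle S (G.inArc c false) = G.circle S (G.inArc c true) :=
    circle_eq_of_joined ⟨c, Or.inr ⟨h, Or.inl ⟨rfl, rfl⟩⟩⟩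
  cases s <;> cases s' <;> simp [this]

theorem circle_outArc_eq_outArc (h : S c = G.positive c) (s s' : Bool) :
    G.circle S (G.outArc c s) = G.circle S (G.outArc c s') := by
  have : G.circle S (G.outArc c false) = G.circle S (G.outArc c true) :=
    circle_eq_of_joined ⟨c, Or.inr ⟨h, Or.inr ⟨rfl, rfl⟩⟩⟩
  cases s <;> cases s' <;> simp [this]

theorem circle_inArc_eq_or (s : Bool) :
    G.circle S (G.inArc c s) = G.circle S (G.inArc c false) ∨
      G.circle S (G.inArc c s) = G.circle S (G.outArc c false) := by
  by_cases h : S c = G.positive c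
  · exact Or.inl (circle_inArc_eq_inArc h _ _)
  · cases s
    · exact Or.inl rfl
    · exact Or.inr (circle_inArc_eq_outArc h true)

theorem circle_outArc_eq_or (s : Bool) :
    G.circle S (G.outArc c s) = G.circle S (G.inArc c false) ∨
      G.circle S (G.outArc c s) = G.circle S (G.outArc c false) := by
  by_cases h : S c = G.positive c
  · exact Or.inr (circle_outArc_eq_outArc h _ _)
  · cases s
    · exact Or.inr rfl
    · exact Or.inl (circle_inArc_eq_outArc h false).symm

/-- In either resolution these two edge ends belong to different local strands at `c`. Both sides
thus say that the two local strands lie on one circle. -/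
theorem circle_inArc_eq_outArc_iff (s : Bool) :
    G.circle S (G.inArc c s) = G.circle S (G.outArc c s) ↔
      G.circle S (G.inArc c false) = G.circle S (G.outArc c false) := by
  by_cases h : S c = G.positive c
  · rw [circle_inArc_eq_inArc h s false, circle_outArc_eq_outArc h s false]
  · cases s
    · rfl
    · rw [circle_inArc_eq_outArc h true, circle_inArc_eq_outArc h false, eq_comm]
      rfl

end

end CrossingGraph

/-- The equivalence relation obtained by identifying `u` and `v`. -/
def Setoid.glue {α : Type*} (r : Setoid α) (u v : α) : Setoid α where
  r a b := r a b ∨ (r a u ∧ r v b) ∨ (r a v ∧ r u b)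
  iseqv :=
    { refl := fun a => Or.inl (r.refl a)
      symm := by
        rintro a b (h | ⟨h1, h2⟩ | ⟨h1, h2⟩)
        · exact Or.inl (r.symm h)
        · exact Or.inr (Or.inr ⟨r.symm h2, r.symm h1⟩)
        · exact Or.inr (Or.inl ⟨r.symm h2, r.symm h1⟩)
      trans := by
        rintro a b c (h | ⟨h1, h2⟩ | ⟨h1, h2⟩) (h' | ⟨h1', h2'⟩ | ⟨h1', h2'⟩)
        · exact Or.inl (r.trans h h')
        · exact Or.inr (Or.inl ⟨r.trans h h1', h2'⟩)
        · exact Or.inr (Or.inr ⟨r.trans h h1', h2'⟩)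
        · exact Or.inr (Or.inl ⟨h1, r.trans h2 h'⟩)
        · exact Or.inr (Or.inl ⟨h1, h2'⟩)
        · exact Or.inl (r.trans h1 h2')
        · exact Or.inr (Or.inr ⟨h1, r.trans h2 h'⟩)
        · exact Or.inl (r.trans h1 h2')
        · exact Or.inr (Or.inr ⟨h1, h2'⟩) }

theorem Setoid.glue_of_or {α : Type*} {r : Setoid α} {u v a b : α} (ha : r a u ∨ r a v)
    (hb : r b u ∨ r b v) : r.glue u v a b := by
  rcases ha with ha | ha <;> rcases hb with hb | hb
  · exact Or.inl (r.trans ha (r.symm hb))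
  · exact Or.inr (Or.inl ⟨ha, r.symm hb⟩)
  · exact Or.inr (Or.inr ⟨ha, r.symm hb⟩)
  · exact Or.inl (r.trans ha (r.symm hb))

/-- When two relations agree up to gluing `u` and `v`, a merge is recognised by testing that pair
alone. -/
theorem Setoid.isMerge_of_le_glue {α : Type*} {r r' : Setoid α} {u v : α} (h : r ≤ r'.glue u v)
    (h' : r' ≤ r.glue u v) (hr : ¬ r u v) (hr' : r' u v) : r.IsMerge r' u v where
  not_rel := hr
  rel_iff a b := by
    have hle : ∀ a b, r a b → r' a b := fun a b hab => by
      rcases h hab with h1 | ⟨h1, h2⟩ | ⟨h1, h2⟩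
      · exact h1
      · exact r'.trans h1 (r'.trans hr' h2)
      · exact r'.trans h1 (r'.trans (r'.symm hr') h2)
    refine ⟨fun hab => h' hab, ?_⟩
    rintro (h1 | ⟨h1, h2⟩ | ⟨h1, h2⟩)
    · exact hle _ _ h1
    · exact r'.trans (hle _ _ h1) (r'.trans hr' (hle _ _ h2))
    · exact r'.trans (hle _ _ h1) (r'.trans (r'.symm hr') (hle _ _ h2))

namespace CrossingGraph

variable {G : CrossingGraph}

/-- All four edge ends at `c` lie on the circles of these two, so gluing them absorbs any way of
joining at `c`. -/
theorem circleRel_le_glue {S S' : Fin G.crossings → Bool} {c : Fin G.crossings}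
    (h : ∀ c', c' ≠ c → S' c' = S c') :
    G.circleRel S' ≤ (G.circleRel S).glue (G.inArc c false) (G.outArc c false) := by
  refine circleRel_le fun e e' hee => ?_
  obtain ⟨c', hc⟩ := hee
  by_cases hcc : c' = c
  · subst hcc
    rcases hc with ⟨-, s, rfl, rfl⟩ | ⟨-, ⟨rfl, rfl⟩ | ⟨rfl, rfl⟩⟩
    · exact Setoid.glue_of_or (circle_inArc_eq_or _) (circle_outArc_eq_or _)
    · exact Setoid.glue_of_or (circle_inArc_eq_or _) (circle_inArc_eq_or _)
    · exact Setoid.glue_of_or (circle_outArc_eq_or _) (circle_outArc_eq_or _)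
  · rw [h c' hcc] at hc
    exact Or.inl (circle_eq_of_joined ⟨c', hc⟩)

end CrossingGraph

/-! ### The circles as cycles of a permutation of the edges -/

namespace LinkDiagram

open CrossingGraph

variable {n : ℕ} {D : LinkDiagram n} {κ : Fin D.regions → Bool}

/-- Colours alternate around the corners of a crossing, so they also alternate along a strand
passing straight through it. -/
theorem colour_left_outArc (hκ : ∀ e, κ (D.right e) = !κ (D.left e)) (c : Fin D.crossings)
    (s : Bool) : κ (D.left (D.outArc c s)) = (s ^^ κ (D.left (D.outArc c false))) := by
  cases s
  · simp
  · have := hκ (D.outArc c true)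
    rw [← D.corner_front] at this
    simp [this]

theorem colour_left_inArc (hκ : ∀ e, κ (D.right e) = !κ (D.left e)) (c : Fin D.crossings)
    (s : Bool) : κ (D.left (D.inArc c s)) = !(s ^^ κ (D.left (D.outArc c false))) := by
  have h1 : κ (D.left (D.inArc c false)) = !κ (D.left (D.outArc c false)) := by
    rw [← D.corner_left, colour_left_outArc hκ]; simp
  cases s
  · simp [h1]
  · rw [← D.corner_back, hκ, h1]; simp

variable (D κ) in
/-- Orient the edges so that black regions are on the left.  These are the two edges which then
arrive at a crossing, the second component telling whether this orientation is reversed. -/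
def arrival (x : Fin D.crossings × Bool) : Fin D.crossings × Bool :=
  if x.2 then (x.1, κ (D.left (D.outArc x.1 false)))
  else D.next.symm (x.1, κ (D.left (D.outArc x.1 false)))

variable (D κ) in
/-- The two edges which leave a crossing in the checkerboard orientation. -/
def departure (x : Fin D.crossings × Bool) : Fin D.crossings × Bool :=
  if x.2 then (x.1, !κ (D.left (D.outArc x.1 false)))
  else D.next.symm (x.1, !κ (D.left (D.outArc x.1 false)))

theorem inl_arrival_false (c : Fin D.crossings) : (Sum.inl (arrival D κ (c, false)) : D.Arc) =
    D.inArc c (κ (D.left (D.outArc c false))) := rfl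

theorem inl_arrival_true (c : Fin D.crossings) : (Sum.inl (arrival D κ (c, true)) : D.Arc) =
    D.outArc c (κ (D.left (D.outArc c false))) := rfl

theorem inl_departure_false (c : Fin D.crossings) : (Sum.inl (departure D κ (c, false)) : D.Arc) =
    D.inArc c (!κ (D.left (D.outArc c false))) := rfl

theorem inl_departure_true (c : Fin D.crossings) : (Sum.inl (departure D κ (c, true)) : D.Arc) =
    D.outArc c (!κ (D.left (D.outArc c false))) := rfl

/-- The colour on the left of the edge tells whether its direction was reversed; the crossing is
then its beginning or its end. -/
theorem arrival_injective (hκ : ∀ e, κ (D.right e) = !κ (D.left e)) :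
    Function.Injective (arrival D κ) := by
  have hcol : ∀ x, κ (D.left (Sum.inl (arrival D κ x))) = !x.2 := by
    rintro ⟨c, _ | _⟩
    · rw [inl_arrival_false, colour_left_inArc hκ]; simp
    · rw [inl_arrival_true, colour_left_outArc hκ]; simp
  intro x y hxy
  have h2 : x.2 = y.2 := by
    have := hcol x
    rw [hxy, hcol y] at this
    simpa using this.symm
  obtain ⟨c, o⟩ := x
  obtain ⟨c', o'⟩ := y
  obtain rfl : o = o' := h2
  cases o
  · have := congrArg Prod.fst (D.next.symm.injective hxy)
    exact Prod.ext this rfl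
  · have : c = c' := congrArg Prod.fst hxy
    rw [this]

theorem departure_injective (hκ : ∀ e, κ (D.right e) = !κ (D.left e)) :
    Function.Injective (departure D κ) := by
  have hcol : ∀ x, κ (D.left (Sum.inl (departure D κ x))) = x.2 := by
    rintro ⟨c, _ | _⟩
    · rw [inl_departure_false, colour_left_inArc hκ]; simp
    · rw [inl_departure_true, colour_left_outArc hκ]; simp
  intro x y hxy
  have h2 : x.2 = y.2 := by rw [← hcol x, hxy, hcol y]
  obtain ⟨c, o⟩ := x
  obtain ⟨c', o'⟩ := y
  obtain rfl : o = o' := h2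
  cases o
  · have := congrArg Prod.fst (D.next.symm.injective hxy)
    exact Prod.ext this rfl
  · have : c = c' := congrArg Prod.fst hxy
    rw [this]

variable (D) in
/-- The strands of a resolution near the crossings, as a permutation. -/
def turn (S : Fin D.crossings → Bool) : Equiv.Perm (Fin D.crossings × Bool) :=
  Function.Involutive.toPerm (fun x => (x.1, if S x.1 = D.positive x.1 then x.2 else !x.2)) (by
    rintro ⟨c, o⟩
    by_cases h : S c = D.positive c <;> simp [h])

theorem turn_apply (S : Fin D.crossings → Bool) (x : Fin D.crossings × Bool) :
    D.turn S x = (x.1, if S x.1 = D.positive x.1 then x.2 else !x.2) := rfl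

/-- The permutation of the edges whose cycles are the circles of the resolution. -/
noncomputable def walk (hκ : ∀ e, κ (D.right e) = !κ (D.left e)) (S : Fin D.crossings → Bool) :
    Equiv.Perm D.Arc :=
  Equiv.sumCongr
    ((Equiv.ofBijective _ (Finite.injective_iff_bijective.1 (arrival_injective hκ))).symm.trans
      ((D.turn S).trans
        (Equiv.ofBijective _ (Finite.injective_iff_bijective.1 (departure_injective hκ)))))
    (Equiv.refl _)

theorem walk_arrival (hκ : ∀ e, κ (D.right e) = !κ (D.left e)) (S : Fin D.crossings → Bool)
    (x : Fin D.crossings × Bool) :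
    walk hκ S (Sum.inl (arrival D κ x)) = Sum.inl (departure D κ (D.turn S x)) := by
  have : (Equiv.ofBijective _ (Finite.injective_iff_bijective.1 (arrival_injective hκ))).symm
      (arrival D κ x) = x := Equiv.ofBijective_symm_apply_apply _ _ x
  simp [walk, this]

theorem walk_inr (hκ : ∀ e, κ (D.right e) = !κ (D.left e)) (S : Fin D.crossings → Bool)
    (l : Fin D.loops) : walk hκ S (Sum.inr l) = Sum.inr l := rfl

theorem exists_arrival (hκ : ∀ e, κ (D.right e) = !κ (D.left e)) (x : Fin D.crossings × Bool) :
    ∃ y, arrival D κ y = x :=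
  (Finite.injective_iff_surjective.1 (arrival_injective hκ)) x

theorem circle_walk (hκ : ∀ e, κ (D.right e) = !κ (D.left e)) (S : Fin D.crossings → Bool)
    (e : D.Arc) : D.circle S (walk hκ S e) = D.circle S e := by
  rcases e with x | l
  · obtain ⟨⟨c, o⟩, rfl⟩ := exists_arrival hκ x
    rw [walk_arrival, turn_apply]
    by_cases h : S c = D.positive c
    · simp only [h, if_true]
      cases o
      · exact circle_inArc_eq_inArc h _ _
      · exact circle_outArc_eq_outArc h _ _
    · simp only [h, if_false]
      cases o
      · exact (circle_inArc_eq_outArc h _).symm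
      · have := circle_inArc_eq_outArc h (!κ (D.left (D.outArc c false)))
        rw [Bool.not_not] at this
        exact this
  · rw [walk_inr]

/-- Both resolutions of a crossing join arriving edges to departing ones, so every join is one step
of the walk, forwards or backwards, and every step is a join. -/
theorem circle_eq_iff_sameCycle (hκ : ∀ e, κ (D.right e) = !κ (D.left e))
    (S : Fin D.crossings → Bool) (e e' : D.Arc) :
    D.circle S e = D.circle S e' ↔ (walk hκ S).SameCycle e e' := by
  constructor
  · refine fun h => circleRel_le (r := Equiv.Perm.SameCycle.setoid (walk hκ S)) ?_ h
    have key : ∀ x, (walk hκ S).SameCycle (Sum.inl (arrival D κ x))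
        (Sum.inl (departure D κ (D.turn S x))) := fun x => by
      rw [← walk_arrival hκ]
      exact (Equiv.Perm.sameCycle_apply_right).2 (Equiv.Perm.SameCycle.refl _ _)
    rintro _ _ ⟨c, h⟩
    have k0 := key (c, false)
    have k1 := key (c, true)
    simp only [turn_apply] at k0 k1
    rcases h with ⟨h, s, rfl, rfl⟩ | ⟨h, ⟨rfl, rfl⟩ | ⟨rfl, rfl⟩⟩
    · simp only [h, if_false, Bool.not_true, Bool.not_false] at k0 k1
      rw [inl_arrival_false, inl_departure_true] at k0
      rw [inl_arrival_true, inl_departure_false] at k1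
      by_cases hs : s = κ (D.left (D.outArc c false))
      · rw [hs]; exact k0
      · have : s = !κ (D.left (D.outArc c false)) := Bool.eq_not.2 hs
        rw [this, Bool.not_not]
        exact k1.symm
    · simp only [h, if_true] at k0 k1
      rw [inl_arrival_false, inl_departure_false] at k0
      cases hb : κ (D.left (D.outArc c false)) <;> rw [hb] at k0
      · exact k0
      · exact k0.symm
    · simp only [h, if_true] at k0 k1
      rw [inl_arrival_true, inl_departure_true] at k1
      cases hb : κ (D.left (D.outArc c false)) <;> rw [hb] at k1
      · exact k1
      · exact k1.symm
  · have hnat : ∀ k : ℕ, ∀ e, D.circle S ((walk hκ S ^ k) e) = D.circle S e := by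
      intro k
      induction k with
      | zero => intro e; rfl
      | succ k ih => intro e; rw [pow_succ, Equiv.Perm.mul_apply, ih, circle_walk]
    intro h
    obtain ⟨k, -, rfl⟩ := h.exists_pow_eq'
    exact (hnat k e).symm

theorem turn_update {S : Fin D.crossings → Bool} {c : Fin D.crossings} (hS : S c = false) :
    D.turn (Function.update S c true) = D.turn S * Equiv.swap (c, false) (c, true) := by
  ext1 ⟨c', o⟩
  rw [Equiv.Perm.mul_apply, turn_apply]
  by_cases hc : c' = c
  · subst hc
    cases o
    · rw [Equiv.swap_apply_left, turn_apply]
      cases D.positive c' <;> simp [hS]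
    · rw [Equiv.swap_apply_right, turn_apply]
      cases D.positive c' <;> simp [hS]
  · rw [Equiv.swap_apply_of_ne_of_ne (by simp [hc]) (by simp [hc]), turn_apply]
    simp [Function.update_of_ne hc]

/-- Changing the resolution exchanges the departures of the two arriving edges at `c`. -/
theorem walk_update (hκ : ∀ e, κ (D.right e) = !κ (D.left e)) {S : Fin D.crossings → Bool}
    {c : Fin D.crossings} (hS : S c = false) :
    walk hκ (Function.update S c true) = walk hκ S *
      Equiv.swap (Sum.inl (arrival D κ (c, false))) (Sum.inl (arrival D κ (c, true))) := by
  ext1 e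
  rw [Equiv.Perm.mul_apply]
  rcases e with x | l
  · obtain ⟨x, rfl⟩ := exists_arrival hκ x
    have hinj : Function.Injective fun x => (Sum.inl (arrival D κ x) : D.Arc) :=
      Sum.inl_injective.comp (arrival_injective hκ)
    have := hinj.swap_apply (c, false) (c, true) x
    rw [this, walk_arrival, walk_arrival, turn_update hS, Equiv.Perm.mul_apply]
  · rw [Equiv.swap_apply_of_ne_of_ne (by simp) (by simp), walk_inr, walk_inr]

variable (D) in
/-- Changing the resolution of a crossing merges two circles or splits a circle. -/
theorem isEdge_circleRel {S : Fin D.crossings → Bool} {c : Fin D.crossings} (hS : S c = false) :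
    Labelling.IsEdge (D.circleRel S) (D.circleRel (Function.update S c true))
      (D.inArc c false) (D.outArc c false) := by
  obtain ⟨κ, hκ⟩ := D.exists_colouring
  set S' := Function.update S c true with hS'
  have h1 : D.circleRel S' ≤ (D.circleRel S).glue (D.inArc c false) (D.outArc c false) :=
    circleRel_le_glue fun c' hc' => Function.update_of_ne hc' _ _
  have h2 : D.circleRel S ≤ (D.circleRel S').glue (D.inArc c false) (D.outArc c false) :=
    circleRel_le_glue fun c' hc' => (Function.update_of_ne hc' _ _).symm
  have hne : (Sum.inl (arrival D κ (c, false)) : D.Arc) ≠ Sum.inl (arrival D κ (c, true)) :=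
    fun h => by simpa using arrival_injective hκ (Sum.inl_injective h)
  have h3 := Equiv.Perm.sameCycle_mul_swap_iff (σ := walk hκ S) hne
  -- The transposition toggles whether its two edges share a cycle: the local strands at `c` lie on
  -- one circle for exactly one of `S` and `S'`.
  rw [← walk_update hκ hS, ← circle_eq_iff_sameCycle, ← circle_eq_iff_sameCycle,
    inl_arrival_false, inl_arrival_true, circle_inArc_eq_outArc_iff (S := S'),
    circle_inArc_eq_outArc_iff (S := S)] at h3
  by_cases h : D.circle S (D.inArc c false) = D.circle S (D.outArc c false)
  · exact Or.inr (Setoid.isMerge_of_le_glue h1 h2 (fun h' => h3.1 h' h) h)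
  · exact Or.inl (Setoid.isMerge_of_le_glue h2 h1 h (h3.2 h))

end LinkDiagram

/-! ### The coefficients of the Khovanov differential -/

namespace CrossingGraph

variable {G : CrossingGraph}

/-- The labels of the edges in an enhanced state. -/
def arcLabel (x : G.EnhancedState) : G.Arc → Bool := fun e => x.2 (G.circle x.1 e)

theorem isConst_arcLabel (x : G.EnhancedState) :
    Labelling.IsConst (G.circleRel x.1) (arcLabel x) := fun _ _ h => congrArg x.2 h

theorem occurs_iff {c : Fin G.crossings} {x y : G.EnhancedState} :
    G.Occurs c x y ↔ x.1 c = false ∧ y.1 = Function.update x.1 c true ∧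
      Labelling.Rule (G.circleRel x.1) (G.circleRel y.1) (G.inArc c false) (G.outArc c false)
        (arcLabel x) (arcLabel y) := by
  constructor
  · rintro ⟨h1, h2, h3, h4⟩
    exact ⟨h1, h2, isConst_arcLabel y, h3, h4⟩
  · rintro ⟨h1, h2, -, h3, h4⟩
    exact ⟨h1, h2, h3, h4⟩

/-- The sign of an edge of the cube of resolutions. -/
def edgeSign (S : Fin G.crossings → Bool) (c : Fin G.crossings) : ℤ :=
  (-1) ^ (Finset.univ.filter fun i => i < c ∧ S i = true).card

theorem edgeSign_update_of_lt {S : Fin G.crossings → Bool} {c c' : Fin G.crossings}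
    (h : c < c') (hS : S c = false) :
    edgeSign (G := G) (Function.update S c true) c' = - edgeSign (G := G) S c' := by
  have : (Finset.univ.filter fun i => i < c' ∧ Function.update S c true i = true) =
      insert c (Finset.univ.filter fun i => i < c' ∧ S i = true) := by
    ext i
    by_cases hi : i = c
    · subst hi; simp [h]
    · simp [hi]
  rw [edgeSign, this, Finset.card_insert_of_notMem (by simp [hS]), pow_succ, edgeSign]
  ring

theorem edgeSign_update_of_gt {S : Fin G.crossings → Bool} {c c' : Fin G.crossings}
    (h : c < c') : edgeSign (G := G) (Function.update S c' true) c = edgeSign (G := G) S c := by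
  have : (Finset.univ.filter fun i => i < c ∧ Function.update S c' true i = true) =
      (Finset.univ.filter fun i => i < c ∧ S i = true) := by
    ext i
    by_cases hi : i = c'
    · subst hi; simp [h.le]
    · simp [Function.update_of_ne hi]
  rw [edgeSign, this, edgeSign]

/-- Changing the smaller of the two crossings first flips the sign of the larger; in the other order
nothing flips. -/
theorem edgeSign_mul {S : Fin G.crossings → Bool} {c c' : Fin G.crossings}
    (h : c ≠ c') (hc : S c = false) (hc' : S c' = false) :
    edgeSign (G := G) S c * edgeSign (G := G) (Function.update S c true) c' =
      -(edgeSign (G := G) S c' * edgeSign (G := G) (Function.update S c' true) c) := by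
  rcases lt_or_gt_of_ne h with h | h
  · rw [edgeSign_update_of_lt h hc, edgeSign_update_of_gt h]; ring
  · rw [edgeSign_update_of_lt h hc', edgeSign_update_of_gt h]; ring

theorem weight_update {S : Fin G.crossings → Bool} {c : Fin G.crossings} (hS : S c = false) :
    G.weight (Function.update S c true) = G.weight S + 1 := by
  have : (Finset.univ.filter fun i => Function.update S c true i = true) =
      insert c (Finset.univ.filter fun i => S i = true) := by
    ext i
    by_cases hi : i = c
    · subst hi; simp
    · simp [hi]
  rw [weight, this, Finset.card_insert_of_notMem (by simp [hS]), weight]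

open Classical in
theorem coeff_eq (x y : G.EnhancedState) :
    G.coeff x y = ∑ c, (if G.Occurs c x y then 1 else 0) * edgeSign (G := G) x.1 c := by
  simp only [coeff, edgeSign, ite_mul, one_mul, zero_mul]

theorem exists_occurs {x y : G.EnhancedState} (h : G.coeff x y ≠ 0) : ∃ c, G.Occurs c x y := by
  rw [coeff] at h
  obtain ⟨c, -, hc⟩ := Finset.exists_ne_zero_of_sum_ne_zero h
  exact ⟨c, by by_contra h'; simp [h'] at hc⟩

theorem hdeg_of_coeff_ne_zero {x y : G.EnhancedState} (h : G.coeff x y ≠ 0) :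
    G.hdeg y = G.hdeg x + 1 := by
  obtain ⟨c, h1, h2, -⟩ := exists_occurs h
  rw [hdeg, hdeg, h2, weight_update h1]
  push_cast
  ring

open Classical in
/-- The number of ways to go from `x` to `z` by changing first `c` and then `c'`. -/
noncomputable def paths (c c' : Fin G.crossings) (x z : G.EnhancedState) : ℤ :=
  ∑ y : G.EnhancedState, (if G.Occurs c x y then 1 else 0) * (if G.Occurs c' y z then 1 else 0)

/-- The intermediate resolution is determined by `x` and `c`, so the signs factor out of the sum
over `y`. -/
theorem sum_coeff_mul_coeff (x z : G.EnhancedState) :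
    ∑ y, G.coeff x y * G.coeff y z = ∑ c, ∑ c', edgeSign (G := G) x.1 c *
      edgeSign (G := G) (Function.update x.1 c true) c' * paths c c' x z := by
  classical
  simp only [coeff_eq, Finset.sum_mul_sum]
  simp only [paths, Finset.mul_sum]
  rw [Finset.sum_comm]
  refine Finset.sum_congr rfl fun c _ => ?_
  rw [Finset.sum_comm]
  refine Finset.sum_congr rfl fun c' _ => Finset.sum_congr rfl fun y _ => ?_
  by_cases h : G.Occurs c x y
  · rw [h.2.1]; ring
  · simp [h]

theorem paths_eq_zero {c c' : Fin G.crossings} {x z : G.EnhancedState}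
    (h : ¬ (c ≠ c' ∧ x.1 c = false ∧ x.1 c' = false ∧
      z.1 = Function.update (Function.update x.1 c true) c' true)) : paths c c' x z = 0 := by
  classical
  refine Finset.sum_eq_zero fun y _ => ?_
  by_contra h'
  obtain ⟨⟨h1, h2, -⟩, h3, h4, -⟩ : G.Occurs c x y ∧ G.Occurs c' y z := by
    by_contra hn
    rcases not_and_or.1 hn with hn | hn <;> simp [hn] at h'
  rw [h2] at h3 h4
  have hne : c ≠ c' := by
    rintro rfl
    simp at h3
  rw [Function.update_of_ne hne.symm] at h3
  exact h ⟨hne, h1, h3, h4⟩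

/-- Enhanced states over `S` are the edge labellings constant on its circles, so counting
intermediate states is composing the two maps of `Labelling`. -/
theorem paths_eq {c c' : Fin G.crossings} {x z : G.EnhancedState} {S : Fin G.crossings → Bool}
    (hne : c ≠ c') (hc : x.1 c = false) (hc' : x.1 c' = false)
    (hS : S = Function.update x.1 c true) (hz : z.1 = Function.update S c' true) :
    paths c c' x z =
      (Labelling.edge (G.circleRel S) (G.circleRel z.1) (G.inArc c' false) (G.outArc c' false)
        (Labelling.edge (G.circleRel x.1) (G.circleRel S) (G.inArc c false) (G.outArc c false)
          (Finsupp.single (arcLabel x) 1))) (arcLabel z) := by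
  classical
  have hSc' : S c' = false := by rw [hS, Function.update_of_ne hne.symm, hc']
  rw [Labelling.edge_single, map_sum, Finset.sum_apply']
  have h1 : ∀ y : G.Arc → Bool,
      (Labelling.edge (G.circleRel S) (G.circleRel z.1) (G.inArc c' false) (G.outArc c' false)
        (if Labelling.Rule (G.circleRel x.1) (G.circleRel S) (G.inArc c false) (G.outArc c false)
          (arcLabel x) y then Finsupp.single y 1 else 0)) (arcLabel z) =
      (if Labelling.Rule (G.circleRel x.1) (G.circleRel S) (G.inArc c false) (G.outArc c false)
          (arcLabel x) y then 1 else 0) *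
      (if Labelling.Rule (G.circleRel S) (G.circleRel z.1) (G.inArc c' false) (G.outArc c' false)
          y (arcLabel z) then 1 else 0) := by
    intro y
    split_ifs with h1 h2 h2
    · rw [Labelling.edge_single, Finset.sum_apply', Finset.sum_eq_single (arcLabel z)]
      · simp [h2]
      · intro b _ hb
        split_ifs
        · simp [hb]
        · rfl
      · simp
    · rw [Labelling.edge_single, Finset.sum_apply']
      refine Finset.sum_eq_zero fun b _ => ?_
      by_cases hb : b = arcLabel z
      · rw [hb, if_neg h2]; rfl
      · split_ifs
        · simp [hb]
        · rfl
    · simp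
    · simp
  rw [Finset.sum_congr rfl fun y _ => h1 y, paths]
  have e1 := Fintype.sum_of_injective (fun s : G.Circle S → Bool => (⟨S, s⟩ : G.EnhancedState))
    (fun s t h => by simpa using h)
    (fun s => (if G.Occurs c x ⟨S, s⟩ then (1 : ℤ) else 0) *
      (if G.Occurs c' ⟨S, s⟩ z then 1 else 0))
    (fun y => (if G.Occurs c x y then (1 : ℤ) else 0) * (if G.Occurs c' y z then 1 else 0))
    (fun y hy => by
      have : ¬ G.Occurs c x y := fun h => hy ⟨(h.2.1.trans hS.symm) ▸ y.2, by
        obtain ⟨T, t⟩ := y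
        obtain rfl : T = S := h.2.1.trans hS.symm
        rfl⟩
      rw [if_neg this, zero_mul]) (fun _ => rfl)
  rw [← e1]
  refine Eq.trans ?_ (Finset.sum_congr (s₁ := (Finset.univ : Finset (G.Arc → Bool)))
    (by ext; simp) fun _ _ => rfl)
  refine Fintype.sum_of_injective (fun s : G.Circle S → Bool => fun e => s (G.circle S e)) ?_
    _ _ ?_ ?_
  · intro s t h
    funext C
    obtain ⟨e, rfl⟩ := G.circle_surjective S C
    exact congrFun h e
  · intro y hy
    have : ¬ Labelling.Rule (G.circleRel x.1) (G.circleRel S) (G.inArc c false)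
        (G.outArc c false) (arcLabel x) y := fun h => hy
      ⟨fun C => y (Function.surjInv (G.circle_surjective S) C), funext fun e =>
        h.1 _ _ (Function.surjInv_eq (G.circle_surjective S) _)⟩
    rw [if_neg this, zero_mul]
  · intro s
    congr 1
    · refine if_congr ?_ rfl rfl
      rw [occurs_iff]
      exact ⟨fun h => h.2.2, fun h => ⟨hc, hS, h⟩⟩
    · refine if_congr ?_ rfl rfl
      rw [occurs_iff]
      exact ⟨fun h => h.2.2, fun h => ⟨hSc', hz, h⟩⟩

end CrossingGraph

/-! ### The square of the differential and the quantum degree -/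

namespace LinkDiagram

open CrossingGraph

variable {n : ℕ} {D : LinkDiagram n}

theorem paths_comm (c c' : Fin D.crossings) (x z : D.EnhancedState) :
    paths c c' x z = paths c' c x z := by
  by_cases h : c ≠ c' ∧ x.1 c = false ∧ x.1 c' = false ∧
      z.1 = Function.update (Function.update x.1 c true) c' true
  · obtain ⟨hne, hc, hc', hz⟩ := h
    have hz' : z.1 = Function.update (Function.update x.1 c' true) c true := by
      rw [hz, Function.update_comm hne]
    rw [paths_eq hne hc hc' rfl hz, paths_eq hne.symm hc' hc rfl hz']
    refine congrArg (fun w : Labelling.Vec D.Arc => w (arcLabel z)) ?_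
    refine Labelling.edge_comm (D.isEdge_circleRel hc) (D.isEdge_circleRel hc') ?_ ?_ _
      (Labelling.single_mem_constVec (isConst_arcLabel x) 1)
    · rw [hz]
      exact D.isEdge_circleRel (by rw [Function.update_of_ne hne.symm, hc'])
    · rw [hz']
      exact D.isEdge_circleRel (by rw [Function.update_of_ne hne, hc])
  · rw [paths_eq_zero h, paths_eq_zero]
    rintro ⟨hne, hc', hc, hz⟩
    exact h ⟨hne.symm, hc, hc', by rw [hz, Function.update_comm hne]⟩

theorem sum_coeff_mul_coeff_eq_zero (x z : D.EnhancedState) :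
    ∑ y, D.coeff x y * D.coeff y z = 0 := by
  rw [sum_coeff_mul_coeff]
  set T : Fin D.crossings → Fin D.crossings → ℤ := fun c c' => edgeSign (G := D.toCrossingGraph)
    x.1 c * edgeSign (G := D.toCrossingGraph) (Function.update x.1 c true) c' * paths c c' x z
    with hT
  have hanti : ∀ c c', T c c' = - T c' c := by
    intro c c'
    by_cases h : c ≠ c' ∧ x.1 c = false ∧ x.1 c' = false ∧
        z.1 = Function.update (Function.update x.1 c true) c' true
    · simp only [hT]
      rw [paths_comm c c', edgeSign_mul h.1 h.2.1 h.2.2.1]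
      ring
    · have h0 := paths_eq_zero h
      simp only [hT]
      rw [paths_comm c' c, h0, mul_zero, mul_zero, neg_zero]
  -- The sum equals its own negative; over `ℤ` this makes it zero, and only afterwards are
  -- coefficients cast to `𝕜`.
  have h1 : ∑ c, ∑ c', T c c' = - ∑ c, ∑ c', T c c' := by
    conv_lhs => rw [Finset.sum_comm]
    simp only [← Finset.sum_neg_distrib]
    exact Finset.sum_congr rfl fun c _ => Finset.sum_congr rfl fun c' _ => hanti c' c
  change ∑ c, ∑ c', T c c' = 0
  omega

/-- In an edge of the cube of resolutions two circles are merged or one circle is split. -/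
theorem merge_or_split {x y : D.EnhancedState} {c : Fin D.crossings} (h : D.Occurs c x y) :
    ((Setoid.ker (D.circle x.1)).IsMerge (Setoid.ker (D.circle y.1)) (D.inArc c false)
        (D.outArc c false) ∧
      MergeRule (x.2 (D.circle x.1 (D.inArc c false))) (x.2 (D.circle x.1 (D.outArc c false)))
        (y.2 (D.circle y.1 (D.inArc c false)))) ∨
    ((Setoid.ker (D.circle y.1)).IsMerge (Setoid.ker (D.circle x.1)) (D.inArc c false)
        (D.outArc c false) ∧
      SplitRule (x.2 (D.circle x.1 (D.inArc c false))) (y.2 (D.circle y.1 (D.inArc c false)))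
        (y.2 (D.circle y.1 (D.outArc c false)))) := by
  obtain ⟨h1, h2, -, h4⟩ := h
  have hedge := D.isEdge_circleRel h1
  rw [← h2] at hedge
  rcases h4 with ⟨h5, h6, h7⟩ | ⟨h5, h6, h7⟩
  · rcases hedge with h8 | h8
    · exact Or.inl ⟨h8, h7⟩
    · exact absurd h8.rel h5
  · rcases hedge with h8 | h8
    · exact absurd h8.rel h6
    · exact Or.inr ⟨h8, h7⟩

/-- Unaffected circles cancel by `sum_add`; what remains is the degree `-1` of the multiplication
and of the comultiplication. -/
theorem sum_sign_of_occurs {x y : D.EnhancedState} {c : Fin D.crossings} (h : D.Occurs c x y) :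
    ∑ C, sign (y.2 C) + 1 = ∑ C, sign (x.2 C) := by
  have hoff := h.2.2.1
  rcases merge_or_split h with ⟨hm, hr⟩ | ⟨hm, hr⟩
  · have := hm.sum_add (D.circle_surjective x.1) (D.circle_surjective y.1)
      (fun C => sign (x.2 C)) (fun C => sign (y.2 C)) fun e h1 h2 => by rw [hoff e h1 h2]
    have hs : sign (y.2 (D.circle y.1 (D.inArc c false))) + 1 =
        sign (x.2 (D.circle x.1 (D.inArc c false))) +
          sign (x.2 (D.circle x.1 (D.outArc c false))) := by
      revert hr
      cases x.2 (D.circle x.1 (D.inArc c false)) <;> cases x.2 (D.circle x.1 (D.outArc c false)) <;>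
        cases y.2 (D.circle y.1 (D.inArc c false)) <;> simp [MergeRule, sign]
    omega
  · have := hm.sum_add (D.circle_surjective y.1) (D.circle_surjective x.1)
      (fun C => sign (y.2 C)) (fun C => sign (x.2 C)) fun e h1 h2 => by
        have h3 : ¬ (D.circle x.1 (D.inArc c false) = D.circle x.1 e) := fun h3 =>
          ((hm.rel_left_iff e).1 h3).elim (fun h => h1 (Eq.symm h)) fun h => h2 (Eq.symm h)
        rw [hoff e (fun h => h3 h.symm) fun h => h3 ((hm.rel : D.circle x.1 _ = _).trans h.symm)]
    have hs : sign (y.2 (D.circle y.1 (D.inArc c false))) +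
        sign (y.2 (D.circle y.1 (D.outArc c false))) + 1 =
          sign (x.2 (D.circle x.1 (D.inArc c false))) := by
      revert hr
      cases x.2 (D.circle x.1 (D.inArc c false)) <;> cases y.2 (D.circle y.1 (D.inArc c false)) <;>
        cases y.2 (D.circle y.1 (D.outArc c false)) <;> simp [SplitRule, sign]
    omega

theorem qdeg_of_coeff_ne_zero {x y : D.EnhancedState} (h : D.coeff x y ≠ 0) :
    D.qdeg y = D.qdeg x := by
  have h1 := hdeg_of_coeff_ne_zero h
  obtain ⟨c, hc⟩ := exists_occurs h
  have h2 := sum_sign_of_occurs hc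
  simp only [hdeg] at h1
  simp only [qdeg]
  omega

variable (D) in
theorem isComplex (𝕜 : Type*) [CommRing 𝕜] : D.IsComplex 𝕜 := by
  classical
  intro i i' i'' j
  refine Finsupp.lhom_ext' fun x => LinearMap.ext_ring (Finsupp.ext fun z => ?_)
  simp only [LinearMap.comp_apply, Finsupp.lsingle_apply, LinearMap.zero_apply, Finsupp.zero_apply,
    CrossingGraph.d, Finsupp.linearCombination_single, one_smul, map_sum]
  have hz : ∀ w : D.States i' j, (∑ y : D.States i'' j,
      Finsupp.single y (D.coeff w.1 y.1 : 𝕜)) z = (D.coeff w.1 z.1 : 𝕜) := by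
    intro w
    rw [Finset.sum_apply', Finset.sum_eq_single z]
    · simp
    · intro b _ hb; simp [hb]
    · simp
  rw [Finset.sum_apply']
  simp only [Finsupp.smul_apply, hz, smul_eq_mul]
  -- States outside the bidegree `(i + 1, j)` have zero coefficient from `x`, so the sum may run
  -- over all enhanced states.
  by_cases hi : i' = i + 1
  · have h1 := Fintype.sum_of_injective (Subtype.val : D.States i' j → D.EnhancedState)
      Subtype.val_injective (fun y => (D.coeff x.1 y.1 : 𝕜) * (D.coeff y.1 z.1 : 𝕜))
      (fun y => (D.coeff x.1 y : 𝕜) * (D.coeff y z.1 : 𝕜)) (fun y hy => by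
        have : D.coeff x.1 y = 0 := by
          by_contra h
          exact hy ⟨⟨y, by rw [hdeg_of_coeff_ne_zero h, x.2.1, hi],
            by rw [qdeg_of_coeff_ne_zero h, x.2.2]⟩, rfl⟩
        rw [this, Int.cast_zero, zero_mul]) (fun _ => rfl)
    rw [h1]
    have := sum_coeff_mul_coeff_eq_zero x.1 z.1
    exact_mod_cast congrArg (Int.cast : ℤ → 𝕜) this
  · refine Finset.sum_eq_zero fun y _ => ?_
    have : D.coeff x.1 y.1 = 0 := by
      by_contra h
      have := hdeg_of_coeff_ne_zero h
      rw [x.2.1, y.2.1] at this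
      exact hi this
    rw [this, Int.cast_zero, zero_mul]

/-! ### The homology classes of the circles -/

open Classical in
variable (D) in
/-- The indicator function modulo `2` of the edges on a circle. -/
noncomputable def circleCochain {S : Fin D.crossings → Bool} (C : D.Circle S) : D.Arc → ZMod 2 :=
  fun e => if D.circle S e = C then 1 else 0

/-- Each local strand of the resolution has two ends at the crossing, so the edges of a circle form
a mod 2 cycle. -/
theorem exists_inside {S : Fin D.crossings → Bool} (C : D.Circle S) :
    ∃ f : Fin D.regions → ZMod 2, f D.outer = 0 ∧ D.coboundary f = D.circleCochain C := by
  refine D.exists_coboundary_eq fun c => ?_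
  rw [Fintype.sum_bool]
  have key : ∀ {e e'}, D.circle S e = D.circle S e' →
      D.circleCochain C e = D.circleCochain C e' := fun h => by
    classical exact if_congr (by rw [h]) rfl rfl
  by_cases h : S c = D.positive c
  · rw [key (circle_inArc_eq_inArc h true false), key (circle_outArc_eq_outArc h true false)]
    exact CharTwo.add_self_eq_zero _
  · rw [key (circle_inArc_eq_outArc h true), key (circle_inArc_eq_outArc h false), Bool.not_true,
      Bool.not_false, add_comm (D.circleCochain C (D.outArc c true))]
    exact CharTwo.add_self_eq_zero _

/-- The inside is unique once its value on the unbounded region is fixed, so any solution `f`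
computes it. -/
theorem encloses_iff {S : Fin D.crossings → Bool} {C : D.Circle S} {f : Fin D.regions → ZMod 2}
    (h0 : f D.outer = 0) (hf : D.coboundary f = D.circleCochain C) (ρ : Fin D.regions) :
    D.Encloses C ρ ↔ f ρ = 1 := by
  classical
  constructor
  · rintro ⟨g, hg0, hg, hgρ⟩
    have : (fun ρ => if g ρ = true then (1 : ZMod 2) else 0) = f := by
      refine D.eq_of_coboundary_eq ?_ (by simp [hg0, h0])
      rw [hf]
      funext e
      simp only [coboundary_apply, circleCochain, ← hg]
      cases g (D.left e) <;> cases g (D.right e) <;> decide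
    rw [← this]
    exact if_pos hgρ
  · intro h
    refine ⟨fun ρ => decide (f ρ = 1), by simp [h0], fun e => ?_, by simp [h]⟩
    have h1 := congrFun hf e
    rw [coboundary_apply] at h1
    simp only [circleCochain] at h1
    dsimp only
    by_cases hC : D.circle S e = C
    · rw [if_pos hC] at h1
      simp only [hC, iff_true]
      revert h1
      generalize f (D.left e) = a
      generalize f (D.right e) = b
      clear * -
      revert a b
      decide
    · rw [if_neg hC] at h1
      simp only [hC, iff_false, not_not]
      rw [CharTwo.add_eq_zero.1 h1]

/-- A circle which is the same in two resolutions encloses the same regions. -/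
theorem homologyClass_congr {S S' : Fin D.crossings → Bool} {e : D.Arc}
    (h : ∀ a, D.circle S a = D.circle S e ↔ D.circle S' a = D.circle S' e) :
    D.homologyClass (D.circle S e) = D.homologyClass (D.circle S' e) := by
  funext k
  have : ∀ ρ, D.Encloses (D.circle S e) ρ ↔ D.Encloses (D.circle S' e) ρ := fun ρ =>
    exists_congr fun f => and_congr_right fun _ => and_congr_left fun _ =>
      forall_congr' fun a => iff_congr Iff.rfl (h a)
  classical exact if_congr (this _) rfl rfl

/-- The homology class modulo `2` is additive when circles are merged. -/
theorem homologyClass_merge {S S' : Fin D.crossings → Bool} {u v : D.Arc}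
    (h : (Setoid.ker (D.circle S)).IsMerge (Setoid.ker (D.circle S')) u v) (k : Fin n) :
    (D.homologyClass (D.circle S u) k = 0 ∧ D.homologyClass (D.circle S v) k = 0 ∧
      D.homologyClass (D.circle S' u) k = 0) ∨
    (D.homologyClass (D.circle S u) k = 0 ∧ D.homologyClass (D.circle S v) k = 1 ∧
      D.homologyClass (D.circle S' u) k = 1) ∨
    (D.homologyClass (D.circle S u) k = 1 ∧ D.homologyClass (D.circle S v) k = 0 ∧
      D.homologyClass (D.circle S' u) k = 1) ∨
    (D.homologyClass (D.circle S u) k = 1 ∧ D.homologyClass (D.circle S v) k = 1 ∧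
      D.homologyClass (D.circle S' u) k = 0) := by
  classical
  obtain ⟨f, hf0, hf⟩ := exists_inside (D.circle S u)
  obtain ⟨g, hg0, hg⟩ := exists_inside (D.circle S v)
  have hfg0 : (f + g) D.outer = 0 := by rw [Pi.add_apply, hf0, hg0, add_zero]
  -- The mod 2 sum of the two insides is the inside of the merged circle; a puncture inside both
  -- nested circles ends up outside.
  have hfg : D.coboundary (f + g) = D.circleCochain (D.circle S' u) := by
    rw [map_add, hf, hg]
    funext e
    have hL : D.circle S' u = D.circle S' e ↔ D.circle S u = D.circle S e ∨
      D.circle S v = D.circle S e := h.rel_left_iff e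
    have hn : D.circle S u ≠ D.circle S v := h.not_rel
    simp only [Pi.add_apply, circleCochain, eq_comm (a := D.circle S e),
      eq_comm (a := D.circle S' e), hL]
    by_cases h1 : D.circle S u = D.circle S e <;> by_cases h2 : D.circle S v = D.circle S e
    · exact absurd (h1.trans h2.symm) hn
    · simp [h1, h2]
    · simp [h1, h2]
    · simp [h1, h2]
  simp only [homologyClass, encloses_iff hf0 hf, encloses_iff hg0 hg, encloses_iff hfg0 hfg,
    Pi.add_apply]
  generalize f (D.puncture k) = a
  generalize g (D.puncture k) = b
  clear * -
  revert a b
  decide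

theorem mdeg_apply (x : D.EnhancedState) (k : Fin n) :
    D.mdeg x k = ∑ C, sign (x.2 C) * D.homologyClass C k := by
  simp [mdeg, Finset.sum_apply]

/-- Fix a puncture. Unaffected circles keep their classes and cancel, leaving a check of the four
patterns of `homologyClass_merge` against the sign rules. For example, merging two circles around
the puncture yields degree `0`, and their signs are never both `-`. -/
theorem mdeg_le_of_coeff_ne_zero {x y : D.EnhancedState} (h : D.coeff x y ≠ 0) :
    D.mdeg y ≤ D.mdeg x := by
  obtain ⟨c, h⟩ := exists_occurs h
  intro k
  rw [mdeg_apply, mdeg_apply]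
  have hoff := h.2.2.1
  rcases merge_or_split h with ⟨hm, hr⟩ | ⟨hm, hr⟩
  · have := hm.sum_add (D.circle_surjective x.1) (D.circle_surjective y.1)
      (fun C => sign (x.2 C) * D.homologyClass C k)
      (fun C => sign (y.2 C) * D.homologyClass C k) fun e h1 h2 => by
        rw [hoff e h1 h2, homologyClass_congr fun a => ?_]
        have := hm.rel_iff_of_not (e := e) (fun h => h1 (Eq.symm h)) (fun h => h2 (Eq.symm h)) a
        exact eq_comm.trans (Iff.trans (Iff.symm this) eq_comm)
    have hs : sign (y.2 (D.circle y.1 (D.inArc c false))) *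
          D.homologyClass (D.circle y.1 (D.inArc c false)) k ≤
        sign (x.2 (D.circle x.1 (D.inArc c false))) *
          D.homologyClass (D.circle x.1 (D.inArc c false)) k +
          sign (x.2 (D.circle x.1 (D.outArc c false))) *
          D.homologyClass (D.circle x.1 (D.outArc c false)) k := by
      revert hr
      rcases homologyClass_merge hm k with ⟨h1, h2, h3⟩ | ⟨h1, h2, h3⟩ | ⟨h1, h2, h3⟩ |
        ⟨h1, h2, h3⟩ <;> rw [h1, h2, h3] <;>
      cases x.2 (D.circle x.1 (D.inArc c false)) <;> cases x.2 (D.circle x.1 (D.outArc c false)) <;>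
        cases y.2 (D.circle y.1 (D.inArc c false)) <;> simp [MergeRule, sign]
    linarith
  · have := hm.sum_add (D.circle_surjective y.1) (D.circle_surjective x.1)
      (fun C => sign (y.2 C) * D.homologyClass C k)
      (fun C => sign (x.2 C) * D.homologyClass C k) fun e h1 h2 => by
        have h3 : ¬ (D.circle x.1 (D.inArc c false) = D.circle x.1 e) := fun h3 =>
          ((hm.rel_left_iff e).1 h3).elim (fun h => h1 (Eq.symm h)) fun h => h2 (Eq.symm h)
        rw [hoff e (fun h => h3 h.symm) fun h => h3 ((hm.rel : D.circle x.1 _ = _).trans h.symm),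
          homologyClass_congr fun a => ?_]
        have := hm.rel_iff_of_not (e := e) (fun h => h1 (Eq.symm h)) (fun h => h2 (Eq.symm h)) a
        exact eq_comm.trans (Iff.trans (Iff.symm this) eq_comm)
    have hs : sign (y.2 (D.circle y.1 (D.inArc c false))) *
          D.homologyClass (D.circle y.1 (D.inArc c false)) k +
          sign (y.2 (D.circle y.1 (D.outArc c false))) *
          D.homologyClass (D.circle y.1 (D.outArc c false)) k ≤
        sign (x.2 (D.circle x.1 (D.inArc c false))) *
          D.homologyClass (D.circle x.1 (D.inArc c false)) k := by
      revert hr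
      rcases homologyClass_merge hm k with ⟨h1, h2, h3⟩ | ⟨h1, h2, h3⟩ | ⟨h1, h2, h3⟩ |
        ⟨h1, h2, h3⟩ <;> rw [h1, h2, h3] <;>
      cases x.2 (D.circle x.1 (D.inArc c false)) <;> cases y.2 (D.circle y.1 (D.inArc c false)) <;>
        cases y.2 (D.circle y.1 (D.outArc c false)) <;> simp [SplitRule, sign]
    linarith

end LinkDiagram

/-! ### The first page -/

namespace LinkDiagram

open CrossingGraph

variable {n : ℕ} (D : LinkDiagram n) (𝕜 : Type*) [CommRing 𝕜]

theorem d_mem_supported {i i' j : ℤ} {s : Set (D.States i j)} {t : Set (D.States i' j)}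
    (h : ∀ x ∈ s, ∀ y : D.States i' j, D.coeff x.1 y.1 ≠ 0 → y ∈ t) {a : D.CKh 𝕜 i j}
    (ha : a ∈ Finsupp.supported 𝕜 𝕜 s) : D.d 𝕜 i i' j a ∈ Finsupp.supported 𝕜 𝕜 t := by
  suffices hle : Finsupp.supported 𝕜 𝕜 s ≤ (Finsupp.supported 𝕜 𝕜 t).comap (D.d 𝕜 i i' j) from
    hle ha
  rw [Finsupp.supported_eq_span_single, Submodule.span_le]
  rintro _ ⟨x, hx, rfl⟩
  change D.d 𝕜 i i' j (Finsupp.single x 1) ∈ Finsupp.supported 𝕜 𝕜 t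
  rw [CrossingGraph.d, Finsupp.linearCombination_single, one_smul]
  refine Submodule.sum_mem _ fun y _ => ?_
  by_cases hy : D.coeff x.1 y.1 = 0
  · rw [hy, Int.cast_zero, Finsupp.single_zero]; exact zero_mem _
  · exact Finsupp.single_mem_supported 𝕜 _ (h x hx y hy)

theorem isFiltered : D.IsFiltered 𝕜 := fun _ _ _ _ _ ha =>
  D.d_mem_supported 𝕜 (fun _ hx _ hy => (mdeg_le_of_coeff_ne_zero hy).trans hx) ha

theorem flatFilt_mono (i j : ℤ) : Monotone (D.flatFilt 𝕜 i j) := fun _ _ h =>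
  Finsupp.supported_mono fun _ hx => le_trans hx h

/-- The Khovanov complex in a quantum degree, with the flattened filtration. -/
noncomputable def filteredComplex (j : ℤ) : FilteredComplex 𝕜 fun i => D.CKh 𝕜 i j where
  d i i' := D.d 𝕜 i i' j
  d_comp i i' i'' := D.isComplex 𝕜 i i' i'' j
  F i p := D.flatFilt 𝕜 i j p
  mono i := D.flatFilt_mono 𝕜 i j
  d_mem _ _ _ _ ha := D.d_mem_supported 𝕜 (fun _ hx _ hy =>
    (Finset.sum_le_sum fun k _ => mdeg_le_of_coeff_ne_zero hy k).trans hx) ha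

theorem exists_flatFilt_bound : ∃ N : ℤ, ∀ i j : ℤ,
    (∀ p ≤ -N, D.flatFilt 𝕜 i j p = ⊥) ∧ ∀ p ≥ N, D.flatFilt 𝕜 i j p = ⊤ := by
  obtain ⟨N, hN⟩ := (Set.finite_range fun x : D.EnhancedState => |∑ k, D.mdeg x k|).bddAbove
  have hN' : ∀ x : D.EnhancedState, |∑ k, D.mdeg x k| ≤ N := fun x => hN ⟨x, rfl⟩
  -- The extra `1` is needed below: a state of degree exactly `-N` would survive in step `-N`.
  refine ⟨N + 1, fun i j => ⟨fun p hp => ?_, fun p hp => ?_⟩⟩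
  · have : {x : D.States i j | ∑ k, D.mdeg x.1 k ≤ p} = ∅ := by
      ext x
      have := neg_le_of_abs_le (hN' x.1)
      simp only [Set.mem_ofPred_eq, Set.mem_empty_iff_false, iff_false]
      omega
    rw [flatFilt, this, Finsupp.supported_empty]
  · have : {x : D.States i j | ∑ k, D.mdeg x.1 k ≤ p} = Set.univ := by
      ext x
      have := le_of_abs_le (hN' x.1)
      simp only [Set.mem_ofPred_eq, Set.mem_univ, iff_true]
      omega
    rw [flatFilt, this, Finsupp.supported_univ]

theorem filtLT_eq (i j : ℤ) (v : Fin n → ℤ) :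
    D.filtLT 𝕜 i j v = Finsupp.supported 𝕜 𝕜 {x | D.mdeg x.1 < v} := by
  refine le_antisymm (iSup₂_le fun u hu => Finsupp.supported_mono fun x hx => lt_of_le_of_lt hx hu)
    ?_
  rw [Finsupp.supported_eq_span_single, Submodule.span_le]
  rintro _ ⟨x, hx, rfl⟩
  exact (le_iSup₂_of_le (f := fun u (_ : u < v) => D.filt 𝕜 i j u) (D.mdeg x.1) hx le_rfl)
    (Finsupp.single_mem_supported 𝕜 _ (show D.mdeg x.1 ≤ D.mdeg x.1 from le_rfl))

theorem filt_le_flatFilt {i j p : ℤ} {v : Fin n → ℤ} (hv : ∑ k, v k = p) :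
    D.filt 𝕜 i j v ≤ D.flatFilt 𝕜 i j p :=
  Finsupp.supported_mono fun _ hx => (Finset.sum_le_sum fun k _ => hx k).trans hv.le

/-- This is why flattening keeps the multigraded pieces apart: comparable degrees with equal sums
coincide. -/
theorem eq_of_le_of_sum_le {u v : Fin n → ℤ} (h : u ≤ v) (hs : ∑ k, v k ≤ ∑ k, u k) : u = v := by
  funext k
  exact (Finset.sum_eq_sum_iff_of_le fun k _ => h k).1
    (le_antisymm (Finset.sum_le_sum fun k _ => h k) hs) k (Finset.mem_univ k)

theorem filtLT_le_flatFilt {i j p : ℤ} {v : Fin n → ℤ} (hv : ∑ k, v k = p) :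
    D.filtLT 𝕜 i j v ≤ D.flatFilt 𝕜 i j (p - 1) := by
  rw [filtLT_eq]
  refine Finsupp.supported_mono fun x (hx : D.mdeg x.1 < v) => ?_
  have h1 : ∑ k, D.mdeg x.1 k ≤ ∑ k, v k := Finset.sum_le_sum fun k _ => hx.le k
  have h2 : ¬ ∑ k, v k ≤ ∑ k, D.mdeg x.1 k := fun h => hx.ne (eq_of_le_of_sum_le hx.le h)
  change ∑ k, D.mdeg x.1 k ≤ p - 1
  omega

open Classical in
/-- The projection to the enhanced states of degree `v`. -/
noncomputable def proj (i j : ℤ) (v : Fin n → ℤ) : D.CKh 𝕜 i j →ₗ[𝕜] D.CKh 𝕜 i j :=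
  (Finsupp.supported 𝕜 𝕜 {x | D.mdeg x.1 = v}).subtype ∘ₗ Finsupp.restrictDom 𝕜 𝕜 _

open Classical in
theorem proj_apply (i j : ℤ) (v : Fin n → ℤ) (a : D.CKh 𝕜 i j) (x : D.States i j) :
    D.proj 𝕜 i j v a x = if D.mdeg x.1 = v then a x else 0 := by
  rw [proj, LinearMap.comp_apply, Submodule.subtype_apply, Finsupp.restrictDom_apply,
    Finsupp.filter_apply]
  rfl

variable {𝕜} {i j : ℤ} {v : Fin n → ℤ}

theorem proj_mem_filt (a : D.CKh 𝕜 i j) : D.proj 𝕜 i j v a ∈ D.filt 𝕜 i j v := by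
  refine (Finsupp.mem_supported' 𝕜 _).2 fun x hx => ?_
  rw [proj_apply, if_neg fun h => hx h.le]

theorem proj_proj (a : D.CKh 𝕜 i j) : D.proj 𝕜 i j v (D.proj 𝕜 i j v a) = D.proj 𝕜 i j v a := by
  ext x
  simp only [proj_apply]
  split_ifs <;> rfl

theorem proj_proj_of_ne {u : Fin n → ℤ} (h : u ≠ v) (a : D.CKh 𝕜 i j) :
    D.proj 𝕜 i j u (D.proj 𝕜 i j v a) = 0 := by
  ext x
  simp only [proj_apply]
  split_ifs with h1 h2
  · exact absurd (h1.symm.trans h2) h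
  · rfl
  · rfl

theorem sub_proj_mem_filtLT {a : D.CKh 𝕜 i j} (ha : a ∈ D.filt 𝕜 i j v) :
    a - D.proj 𝕜 i j v a ∈ D.filtLT 𝕜 i j v := by
  rw [filtLT_eq]
  refine (Finsupp.mem_supported' 𝕜 _).2 fun x hx => ?_
  rw [Finsupp.sub_apply, proj_apply]
  split_ifs with h
  · exact sub_self _
  · rw [sub_zero]
    exact (Finsupp.mem_supported' 𝕜 _).1 ha x fun h' => hx (lt_of_le_of_ne h' h)

theorem proj_eq_zero {p : ℤ} (hv : ∑ k, v k = p) {a : D.CKh 𝕜 i j}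
    (ha : a ∈ D.flatFilt 𝕜 i j (p - 1)) : D.proj 𝕜 i j v a = 0 := by
  ext x
  rw [proj_apply]
  split_ifs with h
  · refine (Finsupp.mem_supported' 𝕜 _).1 ha x fun h' => ?_
    change ∑ k, D.mdeg x.1 k ≤ p - 1 at h'
    rw [h] at h'
    omega
  · rfl

/-- The part of the differential which preserves the degree `v`. -/
theorem proj_d_proj {p i' : ℤ} (hv : ∑ k, v k = p) {a : D.CKh 𝕜 i j}
    (ha : a ∈ D.flatFilt 𝕜 i j p) :
    D.proj 𝕜 i' j v (D.d 𝕜 i i' j (D.proj 𝕜 i j v a)) = D.proj 𝕜 i' j v (D.d 𝕜 i i' j a) := by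
  have h1 : a - D.proj 𝕜 i j v a ∈ Finsupp.supported 𝕜 𝕜
      {x | D.mdeg x.1 ≠ v ∧ ∑ k, D.mdeg x.1 k ≤ p} := by
    refine (Finsupp.mem_supported' 𝕜 _).2 fun x hx => ?_
    rw [Finsupp.sub_apply, proj_apply]
    split_ifs with h
    · exact sub_self _
    · rw [sub_zero]
      exact (Finsupp.mem_supported' 𝕜 _).1 ha x fun h' => hx ⟨h, h'⟩
  -- From another degree of sum at most `p`, the differential cannot reach `v`: it would have to
  -- come from a degree above `v`, hence from `v` itself.
  have h2 := D.d_mem_supported 𝕜 (i' := i') (t := {x | D.mdeg x.1 ≠ v}) (fun x hx y hy h => by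
    have h3 := mdeg_le_of_coeff_ne_zero hy
    rw [h] at h3
    exact hx.1 (eq_of_le_of_sum_le h3 (hx.2.trans hv.ge)).symm) h1
  rw [← sub_eq_zero, ← neg_eq_zero, neg_sub, ← map_sub, ← map_sub]
  ext y
  rw [proj_apply]
  split_ifs with h
  · exact (Finsupp.mem_supported' 𝕜 _).1 h2 y fun h' => h' h
  · rfl

variable {D}

theorem IsFiltered.grD_mk (hF : D.IsFiltered 𝕜) {i' : ℤ} (a : D.filt 𝕜 i j v) :
    hF.grD i i' j v (Submodule.Quotient.mk a) =
      Submodule.Quotient.mk ⟨D.d 𝕜 i i' j a, hF i i' j v a.2⟩ := rfl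

theorem Gr_mk_eq_zero_iff (a : D.filt 𝕜 i j v) :
    (Submodule.Quotient.mk a : D.Gr 𝕜 i j v) = 0 ↔ (a : D.CKh 𝕜 i j) ∈ D.filtLT 𝕜 i j v := by
  rw [Submodule.Quotient.mk_eq_zero]
  rfl

/-- The projection of the cycles of the first page to the degree `v`. -/
noncomputable def IsFiltered.toGr (hF : D.IsFiltered 𝕜) (p i j : ℤ) (v : Fin n → ℤ)
    (hv : ∑ k, v k = p) :
    (D.filteredComplex 𝕜 j).Z 1 p i →ₗ[𝕜] LinearMap.ker (hF.grD i (i + 1) j v) :=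
  LinearMap.codRestrict _ (Submodule.mkQ _ ∘ₗ LinearMap.codRestrict (D.filt 𝕜 i j v)
    (D.proj 𝕜 i j v ∘ₗ Submodule.subtype _) fun a =>
      D.proj_mem_filt (i := i) (j := j) (v := v) a.1) (by
      intro a
      have ha := (FilteredComplex.mem_Z _ rfl rfl).1 a.2
      rw [LinearMap.mem_ker]
      change hF.grD i (i + 1) j v (Submodule.Quotient.mk ⟨D.proj 𝕜 i j v a, _⟩) = 0
      rw [hF.grD_mk, Gr_mk_eq_zero_iff]
      have h1 := D.sub_proj_mem_filtLT (hF i (i + 1) j v (D.proj_mem_filt (v := v) a.1))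
      have h2 := D.proj_eq_zero hv ha.2
      change D.proj 𝕜 (i + 1) j v (D.d 𝕜 i (i + 1) j a) = 0 at h2
      rwa [D.proj_d_proj hv ha.1, h2, sub_zero] at h1)

/-- The projection of the cycles of the first page to multipunctured homology. -/
noncomputable def IsFiltered.toMKh (hF : D.IsFiltered 𝕜) (p i j : ℤ) (v : Fin n → ℤ)
    (hv : ∑ k, v k = p) : (D.filteredComplex 𝕜 j).Z 1 p i →ₗ[𝕜] hF.MKh i j v :=
  Submodule.mkQ _ ∘ₗ hF.toGr p i j v hv

/-- Unwinds both quotients in `MKh`, by boundaries and by lower filtration, into a condition on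
chains. -/
theorem IsFiltered.toMKh_eq_mk_iff (hF : D.IsFiltered 𝕜) {p : ℤ} (hv : ∑ k, v k = p)
    (a : (D.filteredComplex 𝕜 j).Z 1 p i) (b : D.filt 𝕜 i j v)
    (hb : Submodule.Quotient.mk b ∈ LinearMap.ker (hF.grD i (i + 1) j v)) :
    hF.toMKh p i j v hv a = Submodule.Quotient.mk ⟨Submodule.Quotient.mk b, hb⟩ ↔
      ∃ y ∈ D.filt 𝕜 (i - 1) j v,
        D.proj 𝕜 i j v a - b - D.d 𝕜 (i - 1) i j y ∈ D.filtLT 𝕜 i j v := by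
  refine (Submodule.Quotient.eq _).trans ?_
  constructor
  · rintro ⟨y, hy⟩
    obtain ⟨y, rfl⟩ := Submodule.Quotient.mk_surjective _ y
    have h : (Submodule.Quotient.mk (⟨D.proj 𝕜 i j v a, D.proj_mem_filt _⟩ - b) :
      D.Gr 𝕜 i j v) = Submodule.Quotient.mk ⟨D.d 𝕜 (i - 1) i j y, hF _ _ j v y.2⟩ := hy.symm
    have := (Submodule.Quotient.eq _).1 h
    exact ⟨y, y.2, this⟩
  · rintro ⟨y, hy, h⟩
    refine ⟨Submodule.Quotient.mk ⟨y, hy⟩, ?_⟩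
    have : (Submodule.Quotient.mk (⟨D.proj 𝕜 i j v a, D.proj_mem_filt _⟩ - b) :
      D.Gr 𝕜 i j v) = Submodule.Quotient.mk ⟨D.d 𝕜 (i - 1) i j y, hF _ _ j v hy⟩ :=
      (Submodule.Quotient.eq _).2 h
    exact this.symm

theorem IsFiltered.toMKh_eq_zero_iff (hF : D.IsFiltered 𝕜) {p : ℤ} (hv : ∑ k, v k = p)
    (a : (D.filteredComplex 𝕜 j).Z 1 p i) :
    hF.toMKh p i j v hv a = 0 ↔
      ∃ y ∈ D.filt 𝕜 (i - 1) j v,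
        D.proj 𝕜 i j v a - D.d 𝕜 (i - 1) i j y ∈ D.filtLT 𝕜 i j v := by
  have := hF.toMKh_eq_mk_iff hv a 0 (zero_mem _)
  rw [Submodule.coe_zero, sub_zero] at this
  exact this

theorem IsFiltered.toMKh_eq_zero (hF : D.IsFiltered 𝕜) {p : ℤ} (hv : ∑ k, v k = p)
    (a : (D.filteredComplex 𝕜 j).Z 1 p i) (h : D.proj 𝕜 i j v a = 0) :
    hF.toMKh p i j v hv a = 0 := by
  rw [hF.toMKh_eq_zero_iff hv, h]
  exact ⟨0, zero_mem _, by rw [map_zero, sub_zero]; exact zero_mem _⟩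

open Classical in
variable (D) in
/-- The degrees `v` of the enhanced states, with the sum of the coordinates equal to `p`. -/
noncomputable def degrees (i j p : ℤ) : Finset {v : Fin n → ℤ // ∑ k, v k = p} :=
  Finset.subtype _ (Finset.univ.image fun x : D.States i j => D.mdeg x.1)

theorem mdeg_mem_degrees {p : ℤ} (x : D.States i j) (h : ∑ k, D.mdeg x.1 k = p) :
    (⟨D.mdeg x.1, h⟩ : {v : Fin n → ℤ // ∑ k, v k = p}) ∈ D.degrees i j p := by
  simp [degrees, Finset.mem_subtype]

open Classical in
/-- The cycles of the first page represent elements of multipunctured homology. -/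
noncomputable def IsFiltered.toFlatMKh (hF : D.IsFiltered 𝕜) (p i j : ℤ) :
    (D.filteredComplex 𝕜 j).Z 1 p i →ₗ[𝕜] hF.flatMKh i j p :=
  DirectSum.lmk 𝕜 _ _ (D.degrees i j p) ∘ₗ LinearMap.pi fun v => hF.toMKh p i j v.1.1 v.1.2

theorem IsFiltered.toFlatMKh_apply (hF : D.IsFiltered 𝕜) {p : ℤ}
    (a : (D.filteredComplex 𝕜 j).Z 1 p i) (v : {v : Fin n → ℤ // ∑ k, v k = p}) :
    hF.toFlatMKh p i j a v = hF.toMKh p i j v.1 v.2 a := by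
  classical
  refine (DFinsupp.mk_apply).trans ?_
  split_ifs with h
  · rfl
  · refine (hF.toMKh_eq_zero v.2 a ?_).symm
    ext x
    rw [proj_apply]
    split_ifs with h'
    · exact absurd (by have := mdeg_mem_degrees x (h' ▸ v.2); simpa only [h'] using this) h
    · rfl

/-- The degree `v` component of a representative differs from it by lower terms only. It is
therefore still a cycle modulo lower filtration, and all its other components vanish. -/
theorem IsFiltered.toFlatMKh_surjective (hF : D.IsFiltered 𝕜) (p i j : ℤ) :
    Function.Surjective (hF.toFlatMKh p i j) := by
  classical
  intro ξ
  induction ξ using DirectSum.induction_on with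
  | zero => exact ⟨0, map_zero _⟩
  | add ξ η hξ hη =>
    obtain ⟨a, rfl⟩ := hξ
    obtain ⟨b, rfl⟩ := hη
    exact ⟨a + b, map_add _ _ _⟩
  | of v m =>
    obtain ⟨⟨m, hm⟩, rfl⟩ := Submodule.Quotient.mk_surjective _ m
    obtain ⟨a, rfl⟩ := Submodule.Quotient.mk_surjective _ m
    have h1 : D.d 𝕜 i (i + 1) j a ∈ D.filtLT 𝕜 (i + 1) j v.1 := by
      have := LinearMap.mem_ker.1 hm
      rwa [hF.grD_mk, Gr_mk_eq_zero_iff] at this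
    have h2 := D.sub_proj_mem_filtLT a.2
    have h3 : D.d 𝕜 i (i + 1) j (D.proj 𝕜 i j v.1 a) ∈ D.filtLT 𝕜 (i + 1) j v.1 := by
      have := sub_mem h1 (hF.filtLT_le i (i + 1) j v.1 h2)
      rwa [map_sub, sub_sub_cancel] at this
    have h4 : D.proj 𝕜 i j v.1 a ∈ (D.filteredComplex 𝕜 j).Z 1 p i :=
      (FilteredComplex.mem_Z _ rfl rfl).2 ⟨D.filt_le_flatFilt 𝕜 v.2 (D.proj_mem_filt _),
        D.filtLT_le_flatFilt 𝕜 v.2 h3⟩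
    refine ⟨⟨_, h4⟩, DFinsupp.ext fun u => ?_⟩
    refine (hF.toFlatMKh_apply _ u).trans ?_
    by_cases huv : u = v
    · subst huv
      rw [DirectSum.of_eq_same, hF.toMKh_eq_mk_iff]
      refine ⟨0, zero_mem _, ?_⟩
      rw [map_zero, sub_zero, proj_proj, ← neg_mem_iff, neg_sub]
      exact h2
    · rw [DirectSum.of_eq_of_ne _ _ _ huv]
      exact hF.toMKh_eq_zero u.2 _ (D.proj_proj_of_ne (fun h => huv (Subtype.ext h)) _)

theorem sub_sum_proj_mem {p : ℤ} {a : D.CKh 𝕜 i j} (ha : a ∈ D.flatFilt 𝕜 i j p) :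
    a - ∑ v ∈ D.degrees i j p, D.proj 𝕜 i j v.1 a ∈ D.flatFilt 𝕜 i j (p - 1) := by
  classical
  refine (Finsupp.mem_supported' 𝕜 _).2 fun x hx => ?_
  change ¬ ∑ k, D.mdeg x.1 k ≤ p - 1 at hx
  rw [Finsupp.sub_apply, Finset.sum_apply']
  simp only [proj_apply]
  by_cases h : ∑ k, D.mdeg x.1 k = p
  · rw [Finset.sum_eq_single (⟨D.mdeg x.1, h⟩ : {v : Fin n → ℤ // ∑ k, v k = p}),
      if_pos rfl, sub_self]
    · exact fun u _ hu => if_neg fun h' => hu (Subtype.ext h'.symm)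
    · exact fun h' => absurd (mdeg_mem_degrees x h) h'
  · have : a x = 0 := (Finsupp.mem_supported' 𝕜 _).1 ha x fun h' => by
      change ∑ k, D.mdeg x.1 k ≤ p at h'
      omega
    simp [this]

/-- If each component is bounded modulo lower terms by some `y v`, the sum of the `y v` bounds the
whole modulo step `p - 1`. Conversely, the components of a bounding chain bound the components, by
`proj_d_proj`. -/
theorem IsFiltered.ker_toFlatMKh (hF : D.IsFiltered 𝕜) (p i j : ℤ) :
    LinearMap.ker (hF.toFlatMKh p i j) =
      ((D.filteredComplex 𝕜 j).B 1 p i).submoduleOf ((D.filteredComplex 𝕜 j).Z 1 p i) := by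
  ext a
  rw [LinearMap.mem_ker]
  change _ ↔ (a : D.CKh 𝕜 i j) ∈ (D.filteredComplex 𝕜 j).B 1 p i
  rw [FilteredComplex.mem_B _ (sub_add_cancel i 1) (add_sub_cancel_right p 1)]
  have ha := (FilteredComplex.mem_Z _ rfl rfl).1 a.2
  constructor
  · intro h
    have h1 : ∀ v : {v : Fin n → ℤ // ∑ k, v k = p}, ∃ y ∈ D.filt 𝕜 (i - 1) j v.1,
        D.proj 𝕜 i j v.1 a - D.d 𝕜 (i - 1) i j y ∈ D.filtLT 𝕜 i j v.1 := fun v => by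
      rw [← hF.toMKh_eq_zero_iff v.2, ← hF.toFlatMKh_apply, h]
      rfl
    choose y hy hay using h1
    have hyF : ∑ v ∈ D.degrees i j p, y v ∈ D.flatFilt 𝕜 (i - 1) j p :=
      Submodule.sum_mem _ fun v _ => D.filt_le_flatFilt 𝕜 v.2 (hy v)
    have h2 : (a : D.CKh 𝕜 i j) - D.d 𝕜 (i - 1) i j (∑ v ∈ D.degrees i j p, y v) ∈
        D.flatFilt 𝕜 i j (p - 1) := by
      have h3 := add_mem (sub_sum_proj_mem ha.1) (Submodule.sum_mem (D.flatFilt 𝕜 i j (p - 1))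
        fun v (_ : v ∈ D.degrees i j p) => D.filtLT_le_flatFilt 𝕜 v.2 (hay v))
      rwa [Finset.sum_sub_distrib, ← map_sum, sub_add_sub_cancel] at h3
    refine ⟨_, (FilteredComplex.mem_Z _ rfl rfl).2 ⟨h2, ?_⟩, _, hyF,
      (D.filteredComplex 𝕜 j).d_mem _ _ _ _ hyF, sub_add_cancel _ _⟩
    -- Membership in `Z 0` asks only for the filtration degree, since `d` preserves it.
    have := (D.filteredComplex 𝕜 j).d_mem i (i + 1) _ _ h2
    simpa using this
  · rintro ⟨b, hb, y, hy, -, hab⟩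
    refine DFinsupp.ext fun v => ?_
    refine (hF.toFlatMKh_apply _ v).trans ?_
    refine (hF.toMKh_eq_zero_iff v.2 a).2 ⟨D.proj 𝕜 (i - 1) j v.1 y, D.proj_mem_filt y, ?_⟩
    have hb' := D.proj_eq_zero v.2 ((FilteredComplex.mem_Z _ rfl rfl).1 hb).1
    have h1 := D.proj_d_proj (i' := i) v.2 hy
    have h2 : D.proj 𝕜 i j v.1 a = D.proj 𝕜 i j v.1 (D.d 𝕜 (i - 1) i j y) := by
      have h3 : b + D.d 𝕜 (i - 1) i j y = a := hab
      rw [← h3, map_add, hb', zero_add]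
    rw [h2, ← h1, ← neg_mem_iff, neg_sub]
    exact D.sub_proj_mem_filtLT (hF (i - 1) i j v.1 (D.proj_mem_filt y))

/-- The first page is multipunctured Khovanov homology with flattened grading. -/
noncomputable def IsFiltered.firstPageEquiv (hF : D.IsFiltered 𝕜) (p i j : ℤ) :
    (D.filteredComplex 𝕜 j).E 1 p i ≃ₗ[𝕜] hF.flatMKh i j p :=
  LinearMap.quotientEquivOfSurjective (M := (D.filteredComplex 𝕜 j).Z 1 p i)
    (N := hF.flatMKh i j p) (hF.toFlatMKh p i j) (hF.toFlatMKh_surjective p i j)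
    (hF.ker_toFlatMKh p i j)

end LinkDiagram

theorem theorem5 {𝕜 : Type*} [CommRing 𝕜] {n : ℕ} (P : PuncturedDisk n) (L : Link P)
    (D : LinkDiagram n) (hD : L.HasDiagram D) :
    D.IsComplex 𝕜 ∧ ∃ hF : D.IsFiltered 𝕜, ∀ j : ℤ, ∃ E : FiltrationSpectralSequence 𝕜,
      (∀ p i : ℤ, Nonempty ((E.page 1 le_rfl).X (p, i) ≅ ModuleCat.of 𝕜 (hF.flatMKh i j p))) ∧
      E.ConvergesTo (fun i => D.Kh 𝕜 i j) (fun i p => D.flatFiltKh 𝕜 i j p) := by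
  have hF := D.isFiltered 𝕜
  obtain ⟨N, hN⟩ := D.exists_flatFilt_bound 𝕜
  exact ⟨D.isComplex 𝕜, hF, fun j => ⟨(D.filteredComplex 𝕜 j).spectralSequence,
    fun p i => ⟨(hF.firstPageEquiv p i j).toModuleIso⟩,
    (D.filteredComplex 𝕜 j).convergesTo (fun i => (hN i j).1) fun i => (hN i j).2⟩⟩
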